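/- A graph is a directed graph $\Gamma=(V,E,o,t)$ with origin and target maps $o,t:E\to V$ (loops and multiple edges allowed). A graph map is a pair of maps on vertices and on edges that commutes with $o$ and $t$; it is a forwards immersion if, for every vertex $v$, it is injective on the set of edges with origin $v$. The core $\mathrm{core}(\Gamma)$ is the subgraph of $\Gamma$ that is the union of the images of all cycles, i.e. of all graph maps from directed circles (with at least one edge) to $\Gamma$. For graph maps $\gamma:\Gamma\to\Delta$ and $\lambda:\Lambda\to\Delta$, the fibre product $\Gamma\times_\Delta\Lambda$ is the graph with vertices $\{(u,v)\in V(\Gamma)\times V(\Lambda):\gamma(u)=\lambda(v)\}$ and edges $\{(e,f)\in E(\Gamma)\times E(\Lambda):\gamma(e)=\lambda(f)\}$, with coordinatewise origin and target. Two graph maps $f:X\to\Delta$ and $g:Y\to\Delta$ of connected graphs lie in the same free homotopy class if there is a homotopy equivalence $h$ from the geometric realization of $X$ to that of $Y$ such that $g\circ h$ is (freely) homotopic to $f$. The first Betti number $\beta_1$ is the rank of the first homology group, an element of $\mathbb N\cup\{\infty\}$ (with $0\cdot\infty=0$). **Theorem.** Let $\gamma:\Gamma\to\Delta$ and $\lambda:\Lambda\to\Delta$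 be forwards immersions of graphs. Then the restrictions of the natural map $$\theta:\mathrm{core}(\Gamma\times_\Delta\Lambda)\to\Delta$$ to the connected components of $\mathrm{core}(\Gamma\times_\Delta\Lambda)$ represent at most $$40538\cdot(\beta_1(\Gamma)\cdot\beta_1(\Lambda))^2$$ free homotopy classes of maps of connected graphs. -/

import Mathlib

universe u v

/-- A directed graph: vertices, edges, and the origin and target maps.
Loops and multiple edges are allowed. -/
structure DirGraph where
  V : Type u
  E : Type v
  o : E → V
  t : E → V

namespace DirGraph

/-- A graph map. -/
structure Hom (G H : DirGraph) where
  onV : G.V → H.V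
  onE : G.E → H.E
  map_o : ∀ e, onV (G.o e) = H.o (onE e)
  map_t : ∀ e, onV (G.t e) = H.t (onE e)

/-- Composition `g ∘ f` of graph maps. -/
def Hom.comp {G H K : DirGraph} (g : Hom H K) (f : Hom G H) : Hom G K where
  onV := g.onV ∘ f.onV
  onE := g.onE ∘ f.onE
  map_o e := by simp [f.map_o, g.map_o]
  map_t e := by simp [f.map_t, g.map_t]

/-- A forwards immersion: injective on the set of edges starting at any given vertex. -/
def Hom.IsForwardsImmersion {G H : DirGraph} (f : Hom G H) : Prop :=
  ∀ v : G.V, Set.InjOn f.onE {e | G.o e = v}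

/-- The fibre product of two graph maps with the same target. -/
def fibreProduct {G L D : DirGraph} (γ : Hom G D) (l : Hom L D) : DirGraph where
  V := {p : G.V × L.V // γ.onV p.1 = l.onV p.2}
  E := {p : G.E × L.E // γ.onE p.1 = l.onE p.2}
  o e := ⟨(G.o e.1.1, L.o e.1.2), by rw [γ.map_o, l.map_o, e.2]⟩
  t e := ⟨(G.t e.1.1, L.t e.1.2), by rw [γ.map_t, l.map_t, e.2]⟩

/-- The projection of the fibre product to its first factor. -/
def fibreProduct.fst {G L D : DirGraph} (γ : Hom G D) (l : Hom L D) :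
    Hom (fibreProduct γ l) G where
  onV p := p.1.1
  onE p := p.1.1
  map_o _ := rfl
  map_t _ := rfl

/-- The directed circle with `n + 1` vertices and `n + 1` edges, the `i`-th edge going from the
`i`-th vertex to the next one cyclically. -/
def circle (n : ℕ) : DirGraph where
  V := Fin (n + 1)
  E := Fin (n + 1)
  o i := i
  t i := i + 1

/-- The core: the subgraph that is the union of the images of all cycles, a cycle being a graph map
from a directed circle. -/
def core (G : DirGraph) : DirGraph where
  V := {v : G.V // ∃ (n : ℕ) (f : Hom (circle n) G), v ∈ Set.range f.onV}
  E := {e : G.E // ∃ (n : ℕ) (f : Hom (circle n) G), e ∈ Set.range f.onE}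
  o e := ⟨G.o e.1, by
    obtain ⟨n, f, i, hi⟩ := e.2
    exact ⟨n, f, (circle n).o i, by rw [f.map_o, hi]⟩⟩
  t e := ⟨G.t e.1, by
    obtain ⟨n, f, i, hi⟩ := e.2
    exact ⟨n, f, (circle n).t i, by rw [f.map_t, hi]⟩⟩

/-- The inclusion of the core. -/
def coreIncl (G : DirGraph) : Hom (core G) G where
  onV := Subtype.val
  onE := Subtype.val
  map_o _ := rfl
  map_t _ := rfl

/-- The set of connected components: the quotient of the set of vertices by the equivalence
relation generated by adjacency, directions of edges being ignored. -/
def Pi0 (G : DirGraph) : Type _ :=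
  Quot fun u v : G.V => ∃ e : G.E, G.o e = u ∧ G.t e = v

/-- The connected component of a vertex. -/
def toPi0 (G : DirGraph) (v : G.V) : G.Pi0 := Quot.mk _ v

theorem toPi0_t (G : DirGraph) (e : G.E) : G.toPi0 (G.t e) = G.toPi0 (G.o e) :=
  (Quot.sound ⟨e, rfl, rfl⟩).symm

/-- A connected component, as a graph. -/
def component (G : DirGraph) (c : G.Pi0) : DirGraph where
  V := {v : G.V // G.toPi0 v = c}
  E := {e : G.E // G.toPi0 (G.o e) = c}
  o e := ⟨G.o e.1, e.2⟩
  t e := ⟨G.t e.1, (G.toPi0_t e.1).trans e.2⟩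

/-- The inclusion of a connected component. -/
def componentIncl (G : DirGraph) (c : G.Pi0) : Hom (G.component c) G where
  onV := Subtype.val
  onE := Subtype.val
  map_o _ := rfl
  map_t _ := rfl

/-- The cellular boundary map `C₁(G; ℚ) → C₀(G; ℚ)`, `e ↦ t(e) - o(e)`. -/
noncomputable def boundary (G : DirGraph) : (G.E →₀ ℚ) →ₗ[ℚ] (G.V →₀ ℚ) :=
  Finsupp.lmapDomain ℚ ℚ G.t - Finsupp.lmapDomain ℚ ℚ G.o

/-- The first Betti number: the dimension (possibly `∞`) of `H₁(G; ℚ)`, which is the kernel of the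
boundary map because a graph has no cells of dimension two. -/
noncomputable def betti1 (G : DirGraph) : ℕ∞ :=
  Cardinal.toENat (Module.rank ℚ (LinearMap.ker G.boundary))

/-- The disjoint union of the vertices and of one unit interval for each edge. -/
def Cells (G : DirGraph) : Type _ := G.V ⊕ (Σ _ : G.E, unitInterval)

/-- The vertices carry the discrete topology. -/
instance (G : DirGraph) : TopologicalSpace G.Cells :=
  @instTopologicalSpaceSum G.V (Σ _ : G.E, unitInterval) ⊥ inferInstance

/-- The ends of the interval of an edge are glued to the origin and to the target of the edge. -/
inductive Glue (G : DirGraph) : G.Cells → G.Cells → Prop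
  | origin (e : G.E) : Glue G (Sum.inr ⟨e, 0⟩) (Sum.inl (G.o e))
  | target (e : G.E) : Glue G (Sum.inr ⟨e, 1⟩) (Sum.inl (G.t e))

/-- The geometric realization of a graph, a one-dimensional CW complex. -/
def Realization (G : DirGraph) : Type _ := Quot G.Glue

instance (G : DirGraph) : TopologicalSpace G.Realization :=
  inferInstanceAs (TopologicalSpace (Quot G.Glue))

/-- The action of a graph map on vertices and intervals. -/
def Hom.onCells {G H : DirGraph} (f : Hom G H) : G.Cells → H.Cells :=
  Sum.map f.onV fun p => ⟨f.onE p.1, p.2⟩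

theorem Hom.continuous_onCells {G H : DirGraph} (f : Hom G H) : Continuous f.onCells := by
  let _ : TopologicalSpace G.V := ⊥
  let _ : TopologicalSpace H.V := ⊥
  have h1 : Continuous f.onV := continuous_bot
  have h2 : Continuous fun p : Σ _ : G.E, unitInterval =>
      (⟨f.onE p.1, p.2⟩ : Σ _ : H.E, unitInterval) :=
    continuous_sigma fun e => continuous_sigmaMk (σ := fun _ : H.E => unitInterval) (i := f.onE e)
  exact h1.sumMap h2

/-- The continuous map of realizations that is induced by a graph map. -/
def Hom.realize {G H : DirGraph} (f : Hom G H) : C(G.Realization, H.Realization) where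
  toFun := Quot.map f.onCells (by
    rintro _ _ (e | e)
    · have h := Glue.origin (G := H) (f.onE e)
      rw [← f.map_o] at h
      exact h
    · have h := Glue.target (G := H) (f.onE e)
      rw [← f.map_t] at h
      exact h)
  continuous_toFun :=
    continuous_quot_lift _ (continuous_quot_mk.comp f.continuous_onCells)

/-- Two graph maps `f : X → D` and `g : Y → D` are freely homotopic if, up to homotopy, they differ
by a homotopy equivalence between (the realizations of) `X` and `Y`. No base points are involved. -/
def Hom.FreelyHomotopic {X Y D : DirGraph} (f : Hom X D) (g : Hom Y D) : Prop :=
  ∃ h : ContinuousMap.HomotopyEquiv X.Realization Y.Realization,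
    (g.realize.comp h.toFun).Homotopic f.realize

theorem Hom.FreelyHomotopic.refl {X D : DirGraph} (f : Hom X D) : f.FreelyHomotopic f :=
  ⟨ContinuousMap.HomotopyEquiv.refl _, ContinuousMap.Homotopic.refl _⟩

theorem Hom.FreelyHomotopic.symm {X Y D : DirGraph} {f : Hom X D} {g : Hom Y D}
    (H : f.FreelyHomotopic g) : g.FreelyHomotopic f := by
  obtain ⟨h, hh⟩ := H
  refine ⟨h.symm, ?_⟩
  have h1 : (f.realize.comp h.invFun).Homotopic ((g.realize.comp h.toFun).comp h.invFun) :=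
    hh.symm.comp (ContinuousMap.Homotopic.refl _)
  have h2 : (g.realize.comp (h.toFun.comp h.invFun)).Homotopic
      (g.realize.comp (ContinuousMap.id _)) :=
    (ContinuousMap.Homotopic.refl _).comp h.right_inv
  exact h1.trans h2

theorem Hom.FreelyHomotopic.trans {X Y Z D : DirGraph} {f : Hom X D} {g : Hom Y D} {k : Hom Z D}
    (H : f.FreelyHomotopic g) (K : g.FreelyHomotopic k) : f.FreelyHomotopic k := by
  obtain ⟨h, hh⟩ := H
  obtain ⟨j, hj⟩ := K
  refine ⟨h.trans j, ?_⟩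
  have h1 : ((k.realize.comp j.toFun).comp h.toFun).Homotopic (g.realize.comp h.toFun) :=
    hj.comp (ContinuousMap.Homotopic.refl _)
  exact h1.trans hh

/-- The equivalence relation on the components of the source of a graph map `f` which identifies
two components if the restrictions of `f` to them are freely homotopic. -/
def Hom.componentSetoid {G D : DirGraph} (f : Hom G D) : Setoid G.Pi0 where
  r c c' := (f.comp (G.componentIncl c)).FreelyHomotopic (f.comp (G.componentIncl c'))
  iseqv := ⟨fun _ => .refl _, fun h => h.symm, fun h k => h.trans k⟩

/-- The number (possibly `∞`) of free homotopy classes of maps of connected graphs into which a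
graph map splits. -/
noncomputable def Hom.numFreeHomotopyClasses {G D : DirGraph} (f : Hom G D) : ℕ∞ :=
  ENat.card (Quotient f.componentSetoid)

/-- The natural map from the core of the fibre product to the common target. -/
def coreToBase {G L D : DirGraph} (γ : Hom G D) (l : Hom L D) :
    Hom (core (fibreProduct γ l)) D :=
  (γ.comp (fibreProduct.fst γ l)).comp (coreIncl _)

end DirGraph

/-! In the core of each factor, mark a set `B` of vertices, of size linear in the first Betti
number, such that a single core edge starts at each core vertex outside `B` and every cycle meets
`B` (`exists_marking`, by an Euler characteristic count). A component of the core of the fibre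
product may have a vertex in `B ×ˢ B'`; there are at most |B||B'| of these. Otherwise, at each of
its vertices one coordinate is unmarked, so the next edge there is forced, and the common label
forces the other edge. Such a component is a directed circle, that is, a periodic pair of paths with
equal labels. Circles with the same labels and coincidences are isomorphic over the base, so no
further homotopy theory is needed.

Marked times cut both paths of a circle into arcs, and the first edge of an arc determines it
(`IsTrack.gap_eq`). Take a longest arc of the two paths and the arc of the other path around its
midpoint. There are boundedly many such pairs of arcs, and for a given pair only the offset of the
midpoint in the short arc varies. Different offsets place one short word against the same long word.
Once two yes-no questions about the position are settled, differences to a fixed offset are periods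
of the short word on an interval twice as long, so a weak Fine–Wilf theorem puts all offsets in one
residue class modulo a period p (`exists_period_of_placements`).

At the midpoint, then, the second coordinates agree, and the first coordinates lie at distances
divisible by p along a path labelled by a p-periodic word z. All circles that read z forever are
equivalent. Any other circle leaves z at a pair of vertices each of which is marked or is the end of
a maximal z-path. There are at most (|B|+1)(|B'|+1) such pairs, and distinct circles share no vertex
(`card_le_of_reads`). -/

/-! ### Words and their periods -/

/-- `s` has period `d` on the interval `[a, b)`. -/
def PeriodicOn {α : Type*} (s : ℕ → α) (a b d : ℕ) : Prop :=
  ∀ x, a ≤ x → x + d < b → s x = s (x + d)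

/-- The Euclidean step: compare `x` and `x + d - p` through `x + d`, or through `x - p` if `x + d`
is too large. The length hypothesis keeps one of the two detours inside the interval. -/
theorem PeriodicOn.sub {α : Type*} {s : ℕ → α} {a b p d : ℕ} (hp : PeriodicOn s a b p)
    (hd : PeriodicOn s a b d) (hpd : p ≤ d) (h : a + p + d ≤ b) : PeriodicOn s a b (d - p) := by
  intro x hx hxb
  by_cases h1 : x + d < b
  · rw [hd x hx h1, hp (x + (d - p)) (by omega) (by omega)]
    congr 1; omega
  · have e1 := hp (x - p) (by omega) (by omega)
    have e2 := hd (x - p) (by omega) (by omega)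
    rw [Nat.sub_add_cancel (by omega)] at e1
    rw [← e1, e2]
    congr 1; omega

/-- A weak form of the theorem of Fine and Wilf. -/
theorem PeriodicOn.dvd_of_minimal {α : Type*} {s : ℕ → α} {a b p : ℕ} (hp0 : 0 < p)
    (hp : PeriodicOn s a b p) (hmin : ∀ q, 0 < q → PeriodicOn s a b q → p ≤ q) (d : ℕ)
    (hd : PeriodicOn s a b d) (h : a + p + d ≤ b) : p ∣ d := by
  induction d using Nat.strong_induction_on with
  | _ d ih =>
    rcases Nat.eq_zero_or_pos d with rfl | hd0
    · exact dvd_zero _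
    have hpd := hmin d hd0 hd
    have := ih (d - p) (by omega) (hp.sub hd hpd h) (by omega)
    exact (Nat.dvd_sub_iff_left hpd (dvd_refl p)).1 this

theorem PeriodicOn.eq_mod {α : Type*} {s : ℕ → α} {a b p : ℕ} (hp : PeriodicOn s a b p)
    {i : ℕ} (hi : a ≤ i) (t : ℕ) (ht : i + t < b) : s (i + t) = s (i + t % p) := by
  induction t using Nat.strong_induction_on with
  | _ t ih =>
    rcases Nat.eq_zero_or_pos p with rfl | hp0
    · simp
    by_cases h : t < p
    · rw [Nat.mod_eq_of_lt h]
    · push Not at h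
      rw [Nat.mod_eq_sub_mod h, ← ih (t - p) (by omega) (by omega),
        hp (i + (t - p)) (by omega) (by omega)]
      congr 1; omega

/-- If all distances of `j` to elements of `I` are periods of `s` on an interval which is twice as
long, then `I` lies in a residue class of a period of `s`. -/
theorem exists_common_period {α : Type*} {s : ℕ → α} {a b i₀ j : ℕ} {I : Set ℕ} (ha : a ≤ i₀)
    (hi₀ : i₀ ∈ I) (hI : ∀ i ∈ I, i₀ ≤ i ∧ i < b)
    (hper : ∀ i ∈ I, PeriodicOn s a b ((i - j) + (j - i)))
    (hlong : ∀ i ∈ I, a + 2 * ((i - j) + (j - i)) ≤ b) :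
    ∃ (p : ℕ) (z : ℕ → α), (∀ t, z (t + p) = z t) ∧
      ∀ i ∈ I, p ∣ i - i₀ ∧ ∀ x, x ≤ i - i₀ → s (i₀ + x) = z x := by
  classical
  -- The period `b + 1` is vacuous, so a least positive period exists.
  have hex : ∃ p, 0 < p ∧ PeriodicOn s a b p := ⟨b + 1, by omega, fun x _ h => by omega⟩
  set p := Nat.find hex
  obtain ⟨hp0, hpp⟩ := Nat.find_spec hex
  have hmin : ∀ q, 0 < q → PeriodicOn s a b q → p ≤ q := fun q h1 h2 => Nat.find_min' hex ⟨h1, h2⟩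
  have hdvd : ∀ i ∈ I, (p : ℤ) ∣ (i : ℤ) - j := by
    intro i hi
    have h : p ∣ (i - j) + (j - i) := by
      rcases Nat.eq_zero_or_pos ((i - j) + (j - i)) with h0 | h0
      · rw [h0]; exact dvd_zero _
      · have h1 := hmin _ h0 (hper i hi)
        have h2 := hlong i hi
        exact PeriodicOn.dvd_of_minimal hp0 hpp hmin _ (hper i hi) (by omega)
    rcases le_total i j with h1 | h1
    · rw [Nat.sub_eq_zero_of_le h1, zero_add] at h
      rw [← dvd_neg, neg_sub, ← Nat.cast_sub h1]
      exact_mod_cast h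
    · rw [Nat.sub_eq_zero_of_le h1, add_zero] at h
      rw [← Nat.cast_sub h1]
      exact_mod_cast h
  refine ⟨p, fun t => s (i₀ + t % p), fun t => by simp, fun i hi => ⟨?_, fun x hx => ?_⟩⟩
  · have h := dvd_sub (hdvd i hi) (hdvd i₀ hi₀)
    rw [sub_sub_sub_cancel_right, ← Nat.cast_sub (hI i hi).1] at h
    exact_mod_cast h
  · exact hpp.eq_mod ha x (by have := hI i hi; omega)

/-- Placements of a word `s` that cover the midpoint of a word `r` which is not shorter. The set `I`
consists of the offsets in `s` of this midpoint; if its elements are on the same side in two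
respects, they lie in a residue class of a period of `s`. -/
theorem exists_period_of_placements {α : Type*} {s r : ℕ → α} {σ ℓ : ℕ} {I : Set ℕ} (hσ : σ ≤ ℓ)
    (hne : I.Nonempty) (hI : ∀ i ∈ I, i < σ)
    (hov : ∀ i ∈ I, ∀ x y, x < σ → y < ℓ → x + ℓ / 2 = y + i → s x = r y)
    (h1 : (∀ i ∈ I, ℓ / 2 + σ ≤ ℓ + i) ∨ ∀ i ∈ I, ¬ ℓ / 2 + σ ≤ ℓ + i)
    (h2 : (∀ i ∈ I, 2 * i < σ) ∨ ∀ i ∈ I, ¬ 2 * i < σ) :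
    ∃ i₀ ∈ I, ∃ (p : ℕ) (z : ℕ → α), (∀ t, z (t + p) = z t) ∧
      ∀ i ∈ I, i₀ ≤ i ∧ p ∣ i - i₀ ∧ ∀ x, x ≤ i - i₀ → s (i₀ + x) = z x := by
  classical
  obtain ⟨i₀, hi₀, hmin⟩ : ∃ i₀ ∈ I, ∀ i ∈ I, i₀ ≤ i :=
    ⟨Nat.find hne, Nat.find_spec hne, fun i hi => Nat.find_min' hne hi⟩
  have key : ∃ (p : ℕ) (z : ℕ → α), (∀ t, z (t + p) = z t) ∧
      ∀ i ∈ I, p ∣ i - i₀ ∧ ∀ x, x ≤ i - i₀ → s (i₀ + x) = z x := by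
    rcases h1 with h1 | h1
    -- The short word does not overhang the end of the long one. It is then covered from `i₀ - ℓ /
    -- 2` on (truncated: from 0 if it does not overhang the beginning), and comparison with the
    -- placement at the least offset gives the periods.
    · refine exists_common_period (a := i₀ - ℓ / 2) (b := σ) (j := i₀) (by omega) hi₀
        (fun i hi => ⟨hmin i hi, hI i hi⟩) (fun i hi x hx hxb => ?_) fun i hi => ?_
      · have := hmin i hi
        have := h1 i hi
        rw [hov i₀ hi₀ x (x + ℓ / 2 - i₀) (by omega) (by omega) (by omega),
          hov i hi (x + ((i - i₀) + (i₀ - i))) (x + ℓ / 2 - i₀) hxb (by omega) (by omega)]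
      · have := hmin i hi
        have := hI i hi
        have := h1 i₀ hi₀
        -- Offsets in the same half of the short word differ by less than half its length, which
        -- makes the interval long enough.
        rcases h2 with h2 | h2
        · have := h2 i hi; have := h2 i₀ hi₀; omega
        · have := h2 i hi; have := h2 i₀ hi₀; omega
    -- The short word overhangs the end, so its beginning is covered; now the largest offset gives
    -- the longest overlap and serves for comparison.
    · obtain ⟨j, hj, hmax⟩ : ∃ j ∈ I, ∀ i ∈ I, i ≤ j := by
        have hfin : I.Finite := (Set.finite_lt_nat σ).subset hI
        obtain ⟨j, hj, h⟩ := hfin.exists_maximalFor id I hne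
        exact ⟨j, hj, fun i hi => (le_total i j).elim id fun hij => h hi hij⟩
      refine exists_common_period (a := 0) (b := ℓ + j - ℓ / 2) (j := j) (by omega) hi₀
        (fun i hi => ⟨hmin i hi, ?_⟩) (fun i hi x hx hxb => ?_) fun i hi => ?_
      · have := hmax i hi
        have := h1 i hi
        have := hI i hi
        omega
      · have := hmax i hi
        have := h1 i hi
        have := h1 j hj
        rw [hov i hi x (x + ℓ / 2 - i) (by omega) (by omega) (by omega),
          hov j hj (x + ((i - j) + (j - i))) (x + ℓ / 2 - i) (by omega) (by omega) (by omega)]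
      · have := hmax i hi
        have := h1 j hj
        omega
  obtain ⟨p, z, hz, h⟩ := key
  exact ⟨i₀, hi₀, p, z, hz, fun i hi => ⟨hmin i hi, h i hi⟩⟩

/-! ### Gaps in periodic sets of times -/

/-- A gap of a set `P` of natural numbers: consecutive elements `a` and `a + ℓ`. -/
structure IsGap (P : ℕ → Prop) (a ℓ : ℕ) : Prop where
  pos : 0 < ℓ
  left : P a
  right : P (a + ℓ)
  between : ∀ j, 0 < j → j < ℓ → ¬ P (a + j)

theorem exists_gap_around {P : ℕ → Prop} {c : ℕ} (h1 : ∃ a ≤ c, P a) (h2 : ∃ k, c < k ∧ P k) :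
    ∃ a ℓ, IsGap P a ℓ ∧ a ≤ c ∧ c < a + ℓ := by
  classical
  obtain ⟨a₀, ha₀, hPa⟩ := h1
  have hb := Nat.find_spec h2
  have hb' : ∀ k, c < k → P k → Nat.find h2 ≤ k := fun k h h' => Nat.find_min' h2 ⟨h, h'⟩
  have ha := Nat.findGreatest_spec ha₀ hPa
  have hac := Nat.findGreatest_le (P := P) c
  have ha' : ∀ k, Nat.findGreatest P c < k → k ≤ c → ¬ P k := fun k h h' =>
    Nat.findGreatest_is_greatest h h'
  generalize Nat.find h2 = b at *
  generalize Nat.findGreatest P c = a at *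
  refine ⟨a, b - a, ⟨by omega, ha, ?_, fun j hj hjb hPj => ?_⟩, hac, by omega⟩
  · rw [Nat.add_sub_cancel' (by omega)]
    exact hb.2
  · rcases Nat.lt_or_ge c (a + j) with h | h
    · have := hb' _ h hPj
      omega
    · exact ha' _ (by omega) h hPj

theorem add_mul_period {P : ℕ → Prop} {N : ℕ} (hP : ∀ j, P (j + N) ↔ P j) (j k : ℕ) :
    P (j + k * N) ↔ P j := by
  induction k with
  | zero => simp
  | succ k ih => rw [Nat.succ_mul, ← add_assoc, hP, ih]

theorem IsGap.le_period {P : ℕ → Prop} {N a ℓ : ℕ} (hN : 0 < N) (hP : ∀ j, P (j + N) ↔ P j)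
    (h : IsGap P a ℓ) : ℓ ≤ N := by
  by_contra! hlt
  exact h.between N hN hlt ((hP a).2 h.left)

theorem IsGap.add_period {P : ℕ → Prop} {N a ℓ : ℕ} (hP : ∀ j, P (j + N) ↔ P j)
    (h : IsGap P a ℓ) (k : ℕ) : IsGap P (a + k * N) ℓ := by
  refine ⟨h.pos, (add_mul_period hP _ _).2 h.left, ?_, fun j h1 h2 h3 => h.between j h1 h2 ?_⟩
  · rw [add_right_comm]
    exact (add_mul_period hP _ _).2 h.right
  · rw [add_right_comm] at h3
    exact (add_mul_period hP _ _).1 h3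

theorem exists_later_of_periodic {P : ℕ → Prop} {N : ℕ} (hN : 0 < N) (hP : ∀ j, P (j + N) ↔ P j)
    (hex : ∃ j, P j) (c : ℕ) : ∃ k, c < k ∧ P k := by
  obtain ⟨j, hj⟩ := hex
  refine ⟨j + (c + 1) * N, ?_, (add_mul_period hP _ _).2 hj⟩
  nlinarith

theorem exists_longest_gap {P : ℕ → Prop} {N : ℕ} (hN : 0 < N) (hP : ∀ j, P (j + N) ↔ P j)
    (hex : ∃ j, P j) : ∃ a ℓ, IsGap P a ℓ ∧ ∀ a' ℓ', IsGap P a' ℓ' → ℓ' ≤ ℓ := by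
  classical
  obtain ⟨j, hj⟩ := hex
  obtain ⟨a, ℓ, h, -⟩ :=
    exists_gap_around ⟨j, le_rfl, hj⟩ (exists_later_of_periodic hN hP ⟨j, hj⟩ j)
  have hs := Nat.findGreatest_spec (P := fun ℓ => ∃ a, IsGap P a ℓ) (h.le_period hN hP) ⟨a, h⟩
  obtain ⟨a', h'⟩ := hs
  exact ⟨a', _, h', fun b k hk => Nat.le_findGreatest (hk.le_period hN hP) ⟨b, hk⟩⟩

/-- A gap of `Q`, and a gap of `P` around its midpoint which is not longer. -/
def HasLongGap (P Q : ℕ → Prop) (a σ b ℓ : ℕ) : Prop :=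
  IsGap P a σ ∧ IsGap Q b ℓ ∧ σ ≤ ℓ ∧ a ≤ b + ℓ / 2 ∧ b + ℓ / 2 < a + σ

/-- The longer of the two longest gaps dominates every gap of the other set, in particular the one
around its midpoint. -/
theorem exists_hasLongGap {P Q : ℕ → Prop} {N : ℕ} (hN : 0 < N) (hP : ∀ j, P (j + N) ↔ P j)
    (hQ : ∀ j, Q (j + N) ↔ Q j) (hexP : ∃ j, P j) (hexQ : ∃ j, Q j) :
    (∃ a σ b ℓ, HasLongGap P Q a σ b ℓ) ∨ ∃ a σ b ℓ, HasLongGap Q P a σ b ℓ := by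
  have aux : ∀ P Q : ℕ → Prop, (∀ j, P (j + N) ↔ P j) → (∀ j, Q (j + N) ↔ Q j) → (∃ j, P j) →
      ∀ b ℓ m, IsGap Q b ℓ → (∀ a σ, IsGap P a σ → σ ≤ m) → m ≤ ℓ →
      ∃ a σ b ℓ, HasLongGap P Q a σ b ℓ := by
    intro P Q hP hQ hexP b ℓ m hQg hm hmℓ
    obtain ⟨j, hj⟩ := hexP
    -- Shifting by `j` periods ensures that the element `j` of `P` does not come after the midpoint.
    obtain ⟨a, σ, hg, h1, h2⟩ := exists_gap_around (P := P) (c := b + j * N + ℓ / 2)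
      ⟨j, by nlinarith [Nat.zero_le (ℓ / 2)], hj⟩ (exists_later_of_periodic hN hP ⟨j, hj⟩ _)
    exact ⟨a, σ, b + j * N, ℓ, hg, hQg.add_period hQ j, (hm a σ hg).trans hmℓ, h1, h2⟩
  obtain ⟨a, m, ha, hm⟩ := exists_longest_gap hN hP hexP
  obtain ⟨b, n, hb, hn⟩ := exists_longest_gap hN hQ hexQ
  rcases le_total m n with h | h
  · exact Or.inl (aux P Q hP hQ hexP b n m hb hm h)
  · exact Or.inr (aux Q P hQ hP hexQ a m n ha hn h)

namespace DirGraph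

/-! ### Markings, tracks and paths with a given label -/

/-- A set `C` of edges labelled by `lab`, deterministic at all vertices, and with at most one edge
starting at each vertex outside `B`. -/
structure IsMarking {G : DirGraph} {A : Type*} (C : G.E → Prop) (lab : G.E → A)
    (B : Finset G.V) : Prop where
  det : ∀ e e', C e → C e' → G.o e = G.o e' → lab e = lab e' → e = e'
  unique : ∀ e e', C e → C e' → G.o e = G.o e' → G.o e ∉ B → e = e'

/-- An infinite directed path with edges in `C`. -/
structure IsTrack {G : DirGraph} (C : G.E → Prop) (g : ℕ → G.E) : Prop where
  mem : ∀ j, C (g j)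
  next : ∀ j, G.t (g j) = G.o (g (j + 1))

/-- The vertex `u` is reached from `x` by a path in `C` whose labels are the first `n` letters
of `z`. -/
inductive Reads {G : DirGraph} {A : Type*} (C : G.E → Prop) (lab : G.E → A) (z : ℕ → A) (x : G.V) :
    ℕ → G.V → Prop
  | zero : Reads C lab z x 0 x
  | succ {n : ℕ} {e : G.E} : Reads C lab z x n (G.o e) → C e → lab e = z n →
      Reads C lab z x (n + 1) (G.t e)

section

variable {G : DirGraph} {A : Type*} {C : G.E → Prop} {lab : G.E → A} {B : Finset G.V}
  {z : ℕ → A} {x : G.V}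

theorem Reads.eq (hM : IsMarking C lab B) {n : ℕ} {u v : G.V} (hu : Reads C lab z x n u)
    (hv : Reads C lab z x n v) : u = v := by
  induction n generalizing u v with
  | zero => cases hu; cases hv; rfl
  | succ n ih =>
    cases hu with
    | succ h1 h2 h3 =>
      cases hv with
      | succ h1' h2' h3' => rw [hM.det _ _ h2 h2' (ih h1 h1') (h3.trans h3'.symm)]

theorem Reads.exists_edge {n m : ℕ} {u : G.V} (hnm : n < m) (hu : Reads C lab z x m u) :
    ∃ e, C e ∧ lab e = z n ∧ Reads C lab z x n (G.o e) := by
  induction m generalizing u with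
  | zero => omega
  | succ m ih =>
    cases hu with
    | @succ _ e h1 h2 h3 =>
      rcases Nat.lt_succ_iff_lt_or_eq.1 hnm with h | rfl
      · exact ih h h1
      · exact ⟨e, h2, h3, h1⟩

/-- The vertex `u` is reached, and the path cannot be prolonged. -/
def ReadsEnd (C : G.E → Prop) (lab : G.E → A) (z : ℕ → A) (x : G.V) (u : G.V) : Prop :=
  ∃ n, Reads C lab z x n u ∧ ∀ e, C e → G.o e = u → lab e ≠ z n

/-- A path with given labels is unique by determinism, so an end reached earlier could be prolonged
along the longer path. -/
theorem ReadsEnd.eq (hM : IsMarking C lab B) {u v : G.V} (hu : ReadsEnd C lab z x u)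
    (hv : ReadsEnd C lab z x v) : u = v := by
  obtain ⟨n, h1, h2⟩ := hu
  obtain ⟨m, h3, h4⟩ := hv
  rcases lt_trichotomy n m with h | rfl | h
  · obtain ⟨e, he, hl, hr⟩ := h3.exists_edge h
    exact absurd hl (h2 e he (hr.eq hM h1))
  · exact h1.eq hM h3
  · obtain ⟨e, he, hl, hr⟩ := h1.exists_edge h
    exact absurd hl (h4 e he (hr.eq hM h3))

theorem IsTrack.reads {g : ℕ → G.E} (hg : IsTrack C g) {d : ℕ} (h0 : Reads C lab z x d (G.o (g 0)))
    (t : ℕ) (ht : ∀ s < t, lab (g s) = z (d + s)) : Reads C lab z x (d + t) (G.o (g t)) := by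
  induction t with
  | zero => exact h0
  | succ t ih =>
    rw [← hg.next]
    exact Reads.succ (ih fun s hs => ht s (by omega)) (hg.mem t) (ht t (by omega))

/-- When a track leaves the path labelled by `z`, it is in `B` or at the end of that path. -/
theorem IsTrack.mem_or_readsEnd (hM : IsMarking C lab B) {g : ℕ → G.E} (hg : IsTrack C g) {d t : ℕ}
    (h0 : Reads C lab z x d (G.o (g 0))) (ht : ∀ s < t, lab (g s) = z (d + s))
    (hne : lab (g t) ≠ z (d + t)) : G.o (g t) ∈ B ∨ ReadsEnd C lab z x (G.o (g t)) := by
  by_contra! h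
  obtain ⟨h1, h2⟩ := h
  refine h2 ⟨d + t, hg.reads h0 t ht, fun e he ho hl => hne ?_⟩
  rw [hM.unique _ _ (hg.mem t) he ho.symm h1, hl]

theorem IsTrack.shift {g : ℕ → G.E} (hg : IsTrack C g) (k : ℕ) : IsTrack C fun j => g (k + j) :=
  ⟨fun _ => hg.mem _, fun j => hg.next (k + j)⟩

/-- The only choice of edge is at the marked start; afterwards each edge is forced until both tracks
reach a marked vertex at the same time. -/
theorem IsTrack.gap_eq (hM : IsMarking C lab B) {g g' : ℕ → G.E} (hg : IsTrack C g)
    (hg' : IsTrack C g') {a a' ℓ ℓ' : ℕ} (h : IsGap (fun j => G.o (g j) ∈ B) a ℓ)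
    (h' : IsGap (fun j => G.o (g' j) ∈ B) a' ℓ') (he : g a = g' a') :
    ℓ = ℓ' ∧ ∀ j < ℓ, g (a + j) = g' (a' + j) := by
  have aux : ∀ j, j < ℓ → j < ℓ' → g (a + j) = g' (a' + j) := by
    intro j
    induction j with
    | zero => exact fun _ _ => he
    | succ j ih =>
      intro h1 h2
      have ho : G.o (g (a + (j + 1))) = G.o (g' (a' + (j + 1))) := by
        rw [← add_assoc, ← add_assoc, ← hg.next, ← hg'.next, ih (by omega) (by omega)]
      exact hM.unique _ _ (hg.mem _) (hg'.mem _) ho (h.between _ (by omega) h1)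
  have aux' : ∀ j, j < ℓ → j < ℓ' → G.o (g (a + (j + 1))) = G.o (g' (a' + (j + 1))) := by
    intro j h1 h2
    rw [← add_assoc, ← add_assoc, ← hg.next, ← hg'.next, aux j h1 h2]
  have h0 := h.pos
  have h0' := h'.pos
  rcases lt_trichotomy ℓ ℓ' with hlt | rfl | hlt
  · have := aux' (ℓ - 1) (by omega) (by omega)
    rw [Nat.sub_add_cancel h0] at this
    exact absurd (this ▸ h.right) (h'.between ℓ h0 hlt)
  · exact ⟨rfl, fun j hj => aux j hj hj⟩
  · have := aux' (ℓ' - 1) (by omega) (by omega)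
    rw [Nat.sub_add_cancel h0'] at this
    exact absurd (this ▸ h'.right) (h.between ℓ' h0' hlt)

end

/-! ### Counting traces -/

section

variable {G L : DirGraph} {A : Type*}

/-- A pair of edges of `G` and `L` starts at the same pair of vertices as another one. -/
def SameState (g g' : G.E) (h h' : L.E) : Prop := G.o g = G.o g' ∧ L.o h = L.o h'

/-- A periodic pair of paths with the same labels such that the pair of current vertices determines
the future. -/
structure IsTrace (C : G.E → Prop) (C' : L.E → Prop) (γ : G.E → A) (l : L.E → A)
    (g : ℕ → G.E) (h : ℕ → L.E) : Prop where
  fst : IsTrack C g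
  snd : IsTrack C' h
  label : ∀ j, γ (g j) = l (h j)
  periodic : ∃ N, 0 < N ∧ ∀ j, g (j + N) = g j ∧ h (j + N) = h j
  det : ∀ j k, SameState (g j) (g k) (h j) (h k) → g j = g k ∧ h j = h k

theorem IsTrace.swap {C : G.E → Prop} {C' : L.E → Prop} {γ : G.E → A} {l : L.E → A}
    {g : ℕ → G.E} {h : ℕ → L.E} (H : IsTrace C C' γ l g h) : IsTrace C' C l γ h g :=
  ⟨H.snd, H.fst, fun j => (H.label j).symm,
    H.periodic.imp fun _ hN => ⟨hN.1, fun j => (hN.2 j).symm⟩,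
    fun j k hs => (H.det j k hs.symm).symm⟩

theorem IsTrace.shift {C : G.E → Prop} {C' : L.E → Prop} {γ : G.E → A} {l : L.E → A}
    {g : ℕ → G.E} {h : ℕ → L.E} (H : IsTrace C C' γ l g h) (c : ℕ) :
    IsTrace C C' γ l (fun j => g (c + j)) fun j => h (c + j) :=
  ⟨H.fst.shift c, H.snd.shift c, fun j => H.label _,
    H.periodic.imp fun _ hN => ⟨hN.1, fun j => by simpa only [add_assoc] using hN.2 (c + j)⟩,
    fun _ _ hs => H.det _ _ hs⟩

/-- Two traces have the same labels and the same coincidences. -/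
def TraceEquiv (γ : G.E → A) (g g' : ℕ → G.E) (h h' : ℕ → L.E) : Prop :=
  ∃ a b, (∀ j, γ (g (a + j)) = γ (g' (b + j))) ∧
    ∀ j k, SameState (g (a + j)) (g (a + k)) (h (a + j)) (h (a + k)) ↔
      SameState (g' (b + j)) (g' (b + k)) (h' (b + j)) (h' (b + k))

theorem IsTrace.future {C : G.E → Prop} {C' : L.E → Prop} {γ : G.E → A} {l : L.E → A}
    {g : ℕ → G.E} {h : ℕ → L.E} (H : IsTrace C C' γ l g h) {j k : ℕ}
    (hs : SameState (g j) (g k) (h j) (h k)) (i : ℕ) :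
    g (j + i) = g (k + i) ∧ h (j + i) = h (k + i) := by
  induction i with
  | zero => exact H.det j k hs
  | succ i ih =>
    refine H.det _ _ ⟨?_, ?_⟩
    · rw [← add_assoc, ← add_assoc, ← H.fst.next, ← H.fst.next, ih.1]
    · rw [← add_assoc, ← add_assoc, ← H.snd.next, ← H.snd.next, ih.2]

theorem IsTrace.periodic_mul {C : G.E → Prop} {C' : L.E → Prop} {γ : G.E → A} {l : L.E → A}
    {g : ℕ → G.E} {h : ℕ → L.E} (H : IsTrace C C' γ l g h) (d : ℕ) :
    ∃ M, d ≤ M ∧ ∀ j, g (j + M) = g j ∧ h (j + M) = h j := by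
  obtain ⟨N, hN, hp⟩ := H.periodic
  refine ⟨d * N, Nat.le_mul_of_pos_right d hN, fun j => ?_⟩
  induction d with
  | zero => simp
  | succ d ih => rw [Nat.succ_mul, ← add_assoc, (hp _).1, (hp _).2]; exact ih

/-- Two traces that agree after a shift of the first component have the same coincidences. -/
theorem IsTrace.equiv_of_shift {C : G.E → Prop} {C' : L.E → Prop} {γ : G.E → A} {l : L.E → A}
    {g g' : ℕ → G.E} {h h' : ℕ → L.E} (H : IsTrace C C' γ l g h) (H' : IsTrace C C' γ l g' h')
    (d : ℕ) (hg : ∀ j, g (j + d) = g' j) (hh : ∀ j, h j = h' j) : TraceEquiv γ g g' h h' := by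
  refine ⟨0, 0, fun j => ?_, fun j k => ?_⟩
  · rw [zero_add, H.label, hh, H'.label]
  · simp only [zero_add]
    constructor
    · intro hs
      have h1 := H.future hs d
      have h2 := H.future hs 0
      rw [hg, hg] at h1
      rw [hh, hh] at h2
      exact ⟨congrArg G.o h1.1, congrArg L.o h2.2⟩
    · intro hs
      -- Going on until a common period `M ≥ d` is completed undoes the shift by `d`.
      obtain ⟨M, hM, hp⟩ := H.periodic_mul d
      have h1 := (H'.future hs (M - d)).1
      rw [← hg, ← hg, add_assoc, add_assoc, Nat.sub_add_cancel hM, (hp _).1, (hp _).1] at h1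
      refine ⟨congrArg G.o h1, ?_⟩
      rw [hh, hh]
      exact hs.2

/-- Inequivalent and disjoint traces which start at points of a path with periodic labels. -/
theorem card_le_of_reads {ι : Type*} {C : G.E → Prop} {C' : L.E → Prop} {γ : G.E → A} {l : L.E → A}
    {B : Finset G.V} {B' : Finset L.V} (hM : IsMarking C γ B) (hM' : IsMarking C' l B')
    (T : Finset ι) (g : ι → ℕ → G.E) (h : ι → ℕ → L.E)
    (hT : ∀ i ∈ T, IsTrace C C' γ l (g i) (h i))
    (hsep : ∀ i ∈ T, ∀ i' ∈ T, ∀ j k, SameState (g i j) (g i' k) (h i j) (h i' k) → i = i')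
    (hneq : ∀ i ∈ T, ∀ i' ∈ T, TraceEquiv γ (g i) (g i') (h i) (h i') → i = i')
    (z : ℕ → A) (p : ℕ) (hz : ∀ t, z (t + p) = z t) (x : G.V) (y : L.V) (d : ι → ℕ)
    (hd : ∀ i ∈ T, p ∣ d i ∧ Reads C γ z x (d i) (G.o (g i 0)) ∧ L.o (h i 0) = y) :
    T.card ≤ (B.card + 1) * (B'.card + 1) + 1 := by
  classical
  have hzd : ∀ i ∈ T, ∀ t, z (d i + t) = z t := by
    intro i hi t
    obtain ⟨q, hq⟩ := (hd i hi).1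
    rw [hq, add_comm]
    clear hq
    induction q with
    | zero => rfl
    | succ q ih => rw [Nat.mul_succ, ← add_assoc, hz, ih]
  have hrL : ∀ i ∈ T, Reads C' l z y 0 (L.o (h i 0)) := fun i hi => by
    rw [(hd i hi).2.2]; exact Reads.zero
  -- The summand 1 is for the end of the `z`-path, which is unique if it exists.
  have hend : ∃ U : Finset G.V, U.card ≤ B.card + 1 ∧
      ∀ u, u ∈ B ∨ ReadsEnd C γ z x u → u ∈ U := by
    by_cases hex : ∃ u, ReadsEnd C γ z x u
    · obtain ⟨u, hu⟩ := hex
      refine ⟨insert u B, Finset.card_insert_le _ _, ?_⟩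
      rintro v (hv | hv)
      · exact Finset.mem_insert_of_mem hv
      · rw [hv.eq hM hu]; exact Finset.mem_insert_self _ _
    · exact ⟨B, Nat.le_succ _, fun u hu => hu.elim id fun h => absurd ⟨u, h⟩ hex⟩
  have hend' : ∃ U : Finset L.V, U.card ≤ B'.card + 1 ∧
      ∀ u, u ∈ B' ∨ ReadsEnd C' l z y u → u ∈ U := by
    by_cases hex : ∃ u, ReadsEnd C' l z y u
    · obtain ⟨u, hu⟩ := hex
      refine ⟨insert u B', Finset.card_insert_le _ _, ?_⟩
      rintro v (hv | hv)
      · exact Finset.mem_insert_of_mem hv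
      · rw [hv.eq hM' hu]; exact Finset.mem_insert_self _ _
    · exact ⟨B', Nat.le_succ _, fun u hu => hu.elim id fun h => absurd ⟨u, h⟩ hex⟩
  obtain ⟨U, hUc, hU⟩ := hend
  obtain ⟨U', hUc', hU'⟩ := hend'
  set T₁ := T.filter fun i => ∀ t, γ (g i t) = z t
  set T₂ := T.filter fun i => ¬ ∀ t, γ (g i t) = z t
  have hcard : T.card = T₁.card + T₂.card := (Finset.card_filter_add_card_filter_not _).symm
  -- Two traces that read `z` forever have equal second components, and their first components run
  -- along the same `z`-path with a delay, so `equiv_of_shift` applies.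
  have c1 : T₁.card ≤ 1 := by
    rw [Finset.card_le_one]
    have aux : ∀ i ∈ T₁, ∀ i' ∈ T₁, d i ≤ d i' → i = i' := by
      intro i hi i' hi' hdd
      obtain ⟨hiT, hiz⟩ := Finset.mem_filter.1 hi
      obtain ⟨hiT', hiz'⟩ := Finset.mem_filter.1 hi'
      have H := hT i hiT
      have H' := hT i' hiT'
      refine hneq i hiT i' hiT' (H.equiv_of_shift H' (d i' - d i) (fun j => ?_) fun j => ?_)
      · have r1 := H.fst.reads (hd i hiT).2.1 (j + (d i' - d i)) fun s _ => by
          rw [hiz, hzd i hiT]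
        have r2 := H'.fst.reads (hd i' hiT').2.1 j fun s _ => by rw [hiz', hzd i' hiT']
        rw [show d i + (j + (d i' - d i)) = d i' + j by omega] at r1
        refine hM.det _ _ (H.fst.mem _) (H'.fst.mem _) (r1.eq hM r2) ?_
        rw [hiz, hiz']
        have e1 := hzd i hiT (j + (d i' - d i))
        have e2 := hzd i' hiT' j
        rw [show d i + (j + (d i' - d i)) = d i' + j by omega] at e1
        rw [← e1, e2]
      · have r1 := H.snd.reads (hrL i hiT) j fun s _ => by rw [← H.label, hiz, zero_add]
        have r2 := H'.snd.reads (hrL i' hiT') j fun s _ => by rw [← H'.label, hiz', zero_add]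
        refine hM'.det _ _ (H.snd.mem _) (H'.snd.mem _) (r1.eq hM' r2) ?_
        rw [← H.label, ← H'.label, hiz, hiz']
    intro i hi i' hi'
    rcases le_total (d i) (d i') with h1 | h1
    · exact aux i hi i' hi' h1
    · exact (aux i' hi' i hi h1).symm
  -- At the first label that differs from `z`, both coordinates leave their `z`-paths
  -- simultaneously, because the labels agree.
  have hleave : ∀ i ∈ T₂, ∃ t, G.o (g i t) ∈ U ∧ L.o (h i t) ∈ U' := by
    intro i hi
    obtain ⟨hiT, hiz⟩ := Finset.mem_filter.1 hi
    have H := hT i hiT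
    push Not at hiz
    have h1 := Nat.find_spec hiz
    have h2 : ∀ s < Nat.find hiz, γ (g i s) = z s := fun s hs => not_not.1 (Nat.find_min hiz hs)
    refine ⟨Nat.find hiz, hU _ (H.fst.mem_or_readsEnd hM (hd i hiT).2.1 (fun s hs => ?_) ?_),
      hU' _ (H.snd.mem_or_readsEnd hM' (hrL i hiT) (fun s hs => ?_) ?_)⟩
    · rw [hzd i hiT, h2 s hs]
    · rwa [hzd i hiT]
    · rw [zero_add, ← H.label, h2 s hs]
    · rwa [zero_add, ← H.label]
  choose! t ht using hleave
  have c2 : T₂.card ≤ (U ×ˢ U').card := by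
    refine Finset.card_le_card_of_injOn (fun i => (G.o (g i (t i)), L.o (h i (t i))))
      (fun i hi => Finset.mem_coe.2 (Finset.mem_product.2 (ht i hi))) fun i hi i' hi' he => ?_
    have he' := Prod.mk.inj he
    exact hsep i (Finset.mem_filter.1 hi).1 i' (Finset.mem_filter.1 hi').1 _ _ he'
  rw [Finset.card_product] at c2
  have := Nat.mul_le_mul hUc hUc'
  omega

/-- Inequivalent and disjoint traces with a long gap in the second component. -/
theorem card_le_of_hasLongGap {ι : Type*} {C : G.E → Prop} {C' : L.E → Prop} {γ : G.E → A}
    {l : L.E → A} {B : Finset G.V} {B' : Finset L.V} (hM : IsMarking C γ B)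
    (hM' : IsMarking C' l B') {E : Finset G.E} {E' : Finset L.E}
    (hE : ∀ e, C e → G.o e ∈ B → e ∈ E) (hE' : ∀ e, C' e → L.o e ∈ B' → e ∈ E')
    (T : Finset ι) (g : ι → ℕ → G.E) (h : ι → ℕ → L.E)
    (hT : ∀ i ∈ T, IsTrace C C' γ l (g i) (h i))
    (hsep : ∀ i ∈ T, ∀ i' ∈ T, ∀ j k, SameState (g i j) (g i' k) (h i j) (h i' k) → i = i')
    (hneq : ∀ i ∈ T, ∀ i' ∈ T, TraceEquiv γ (g i) (g i') (h i) (h i') → i = i')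
    (hgap : ∀ i ∈ T, ∃ a σ b ℓ,
      HasLongGap (fun j => G.o (g i j) ∈ B) (fun j => L.o (h i j) ∈ B') a σ b ℓ) :
    T.card ≤ ((B.card + 1) * (B'.card + 1) + 1) * (E.card * E'.card * 4) := by
  classical
  choose! a σ b ℓ hgap using hgap
  -- The first edges determine the two arcs. The bits record whether the short arc ends within the
  -- long one, and in which half of the short arc the midpoint lies.
  let key : ι → (G.E × L.E) × Bool × Bool := fun i =>
    ((g i (a i), h i (b i)), decide (ℓ i / 2 + σ i ≤ ℓ i + (b i + ℓ i / 2 - a i)),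
      decide (2 * (b i + ℓ i / 2 - a i) < σ i))
  have hmaps : ∀ i ∈ T, key i ∈ (E ×ˢ E') ×ˢ (Finset.univ : Finset (Bool × Bool)) := by
    intro i hi
    obtain ⟨h1, h2, -⟩ := hgap i hi
    simp only [key, Finset.mem_product, Finset.mem_univ, and_true]
    exact ⟨hE _ ((hT i hi).fst.mem _) h1.left, hE' _ ((hT i hi).snd.mem _) h2.left⟩
  have hfib : ∀ k ∈ (E ×ˢ E') ×ˢ (Finset.univ : Finset (Bool × Bool)),
      (T.filter fun i => key i = k).card ≤ (B.card + 1) * (B'.card + 1) + 1 := by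
    intro k _
    set S := T.filter fun i => key i = k
    rcases S.eq_empty_or_nonempty with h0 | ⟨i₁, hi₁⟩
    · rw [h0, Finset.card_empty]; exact Nat.zero_le _
    have hST : ∀ i ∈ S, i ∈ T := fun i hi => (Finset.mem_filter.1 hi).1
    have hkey : ∀ i ∈ S, key i = key i₁ := fun i hi =>
      (Finset.mem_filter.1 hi).2.trans (Finset.mem_filter.1 hi₁).2.symm
    have hG : ∀ i ∈ S, σ i = σ i₁ ∧ ∀ j < σ i, g i (a i + j) = g i₁ (a i₁ + j) := fun i hi =>
      (hT i (hST i hi)).fst.gap_eq hM (hT _ (hST _ hi₁)).fst (hgap i (hST i hi)).1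
        (hgap _ (hST _ hi₁)).1 (congrArg (fun k => k.1.1) (hkey i hi))
    have hL : ∀ i ∈ S, ℓ i = ℓ i₁ ∧ ∀ j < ℓ i, h i (b i + j) = h i₁ (b i₁ + j) := fun i hi =>
      (hT i (hST i hi)).snd.gap_eq hM' (hT _ (hST _ hi₁)).snd (hgap i (hST i hi)).2.1
        (hgap _ (hST _ hi₁)).2.1 (congrArg (fun k => k.1.2) (hkey i hi))
    have hb1 : ∀ i ∈ S, (ℓ i / 2 + σ i ≤ ℓ i + (b i + ℓ i / 2 - a i)) ↔
        (ℓ i₁ / 2 + σ i₁ ≤ ℓ i₁ + (b i₁ + ℓ i₁ / 2 - a i₁)) := fun i hi =>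
      decide_eq_decide.1 (congrArg (fun k => k.2.1) (hkey i hi))
    have hb2 : ∀ i ∈ S, (2 * (b i + ℓ i / 2 - a i) < σ i) ↔
        (2 * (b i₁ + ℓ i₁ / 2 - a i₁) < σ i₁) := fun i hi =>
      decide_eq_decide.1 (congrArg (fun k => k.2.2) (hkey i hi))
    obtain ⟨_, ⟨i₀, hi₀, rfl⟩, p, z, hz, hI⟩ := exists_period_of_placements
      (s := fun x => γ (g i₁ (a i₁ + x))) (r := fun y => l (h i₁ (b i₁ + y)))
      (σ := σ i₁) (ℓ := ℓ i₁) (I := (fun i => b i + ℓ i / 2 - a i) '' (S : Set ι))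
      (hgap _ (hST _ hi₁)).2.2.1 ⟨_, i₁, hi₁, rfl⟩
      (by
        rintro _ ⟨i, hi, rfl⟩
        have := hgap i (hST i hi)
        have := (hG i hi).1
        simp only [HasLongGap] at *
        omega)
      (by
        rintro _ ⟨i, hi, rfl⟩ x y hx hy hxy
        have h1 := hgap i (hST i hi)
        have h2 := hG i hi
        have h3 := hL i hi
        have h4 := (hT i (hST i hi)).label (a i + x)
        simp only [HasLongGap] at h1
        simp only at hxy
        rw [h2.2 x (by omega), show a i + x = b i + y by omega, h3.2 y (by omega)] at h4
        exact h4)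
      (by
        by_cases hc : ℓ i₁ / 2 + σ i₁ ≤ ℓ i₁ + (b i₁ + ℓ i₁ / 2 - a i₁)
        · left
          rintro _ ⟨i, hi, rfl⟩
          simpa only [(hL i hi).1, (hG i hi).1] using (hb1 i hi).2 hc
        · right
          rintro _ ⟨i, hi, rfl⟩
          simpa only [(hL i hi).1, (hG i hi).1] using mt (hb1 i hi).1 hc)
      (by
        by_cases hc : 2 * (b i₁ + ℓ i₁ / 2 - a i₁) < σ i₁
        · left
          rintro _ ⟨i, hi, rfl⟩
          simpa only [(hG i hi).1] using (hb2 i hi).2 hc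
        · right
          rintro _ ⟨i, hi, rfl⟩
          simpa only [(hG i hi).1] using mt (hb2 i hi).1 hc)
    replace hI := fun i (hi : i ∈ S) => hI _ ⟨i, hi, rfl⟩
    simp only at hI
    -- All traces are restarted at the midpoint of the long arc; `i₀` has the least offset, so the
    -- others start further along the short arc.
    refine card_le_of_reads hM hM' S (fun i j => g i (b i + ℓ i / 2 + j))
      (fun i j => h i (b i + ℓ i / 2 + j)) (fun i hi => (hT i (hST i hi)).shift _)
      (fun i hi i' hi' j k hs => hsep i (hST i hi) i' (hST i' hi') _ _ hs)
      (fun i hi i' hi' he => hneq i (hST i hi) i' (hST i' hi') ?_) z p hz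
      (G.o (g i₀ (b i₀ + ℓ i₀ / 2))) (L.o (h i₀ (b i₀ + ℓ i₀ / 2)))
      (fun i => (b i + ℓ i / 2 - a i) - (b i₀ + ℓ i₀ / 2 - a i₀)) fun i hi => ?_
    · obtain ⟨u, v, h1, h2⟩ := he
      refine ⟨b i + ℓ i / 2 + u, b i' + ℓ i' / 2 + v, fun j => ?_, fun j k => ?_⟩
      · simpa only [add_assoc] using h1 j
      · simpa only [add_assoc] using h2 j k
    · obtain ⟨hle, hdvd, hlab⟩ := hI i hi
      have g0 := hgap i₀ (hST _ hi₀)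
      have g1 := hgap i (hST _ hi)
      simp only [HasLongGap] at g0 g1
      have s0 := hG i₀ hi₀
      have s1 := hG i hi
      have l0 := hL i₀ hi₀
      have l1 := hL i hi
      refine ⟨hdvd, ?_, ?_⟩
      · have hr := ((hT i₀ (hST _ hi₀)).fst.shift (b i₀ + ℓ i₀ / 2)).reads (lab := γ) (z := z)
          (x := G.o (g i₀ (b i₀ + ℓ i₀ / 2))) (d := 0) Reads.zero
          ((b i + ℓ i / 2 - a i) - (b i₀ + ℓ i₀ / 2 - a i₀)) fun s hs => ?_
        · rw [zero_add] at hr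
          convert hr using 2
          have e1 := s1.2 (b i + ℓ i / 2 - a i) (by omega)
          have e0 := s0.2 (b i + ℓ i / 2 - a i) (by omega)
          rw [← e0] at e1
          convert e1 using 2 <;> omega
        · have e0 := s0.2 (b i₀ + ℓ i₀ / 2 - a i₀ + s) (by omega)
          rw [zero_add, ← hlab s (by omega), ← e0]
          congr 2
          omega
      · have e1 := l1.2 (ℓ i / 2) (by omega)
        have e0 := l0.2 (ℓ i / 2) (by omega)
        have : ℓ i = ℓ i₀ := l1.1.trans l0.1.symm
        rw [add_zero, e1, ← e0, this]
  refine (Finset.card_le_mul_card_image_of_maps_to hmaps _ hfib).trans (le_of_eq ?_)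
  simp [Finset.card_product]

/-- Inequivalent and disjoint traces that meet the marked vertices. -/
theorem card_traces_le {ι : Type*} {C : G.E → Prop} {C' : L.E → Prop} {γ : G.E → A}
    {l : L.E → A} {B : Finset G.V} {B' : Finset L.V} (hM : IsMarking C γ B)
    (hM' : IsMarking C' l B') {E : Finset G.E} {E' : Finset L.E}
    (hE : ∀ e, C e → G.o e ∈ B → e ∈ E) (hE' : ∀ e, C' e → L.o e ∈ B' → e ∈ E')
    (T : Finset ι) (g : ι → ℕ → G.E) (h : ι → ℕ → L.E)
    (hT : ∀ i ∈ T, IsTrace C C' γ l (g i) (h i))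
    (hsep : ∀ i ∈ T, ∀ i' ∈ T, ∀ j k, SameState (g i j) (g i' k) (h i j) (h i' k) → i = i')
    (hneq : ∀ i ∈ T, ∀ i' ∈ T, TraceEquiv γ (g i) (g i') (h i) (h i') → i = i')
    (hB : ∀ i ∈ T, ∃ j, G.o (g i j) ∈ B) (hB' : ∀ i ∈ T, ∃ j, L.o (h i j) ∈ B') :
    T.card ≤ ((B.card + 1) * (B'.card + 1) + 1) * (E.card * E'.card * 8) := by
  classical
  set P : ι → Prop := fun i => ∃ a σ b ℓ,
    HasLongGap (fun j => G.o (g i j) ∈ B) (fun j => L.o (h i j) ∈ B') a σ b ℓ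
  have c1 := card_le_of_hasLongGap hM hM' hE hE' (T.filter P) g h
    (fun i hi => hT i (Finset.mem_filter.1 hi).1)
    (fun i hi i' hi' => hsep i (Finset.mem_filter.1 hi).1 i' (Finset.mem_filter.1 hi').1)
    (fun i hi i' hi' => hneq i (Finset.mem_filter.1 hi).1 i' (Finset.mem_filter.1 hi').1)
    fun i hi => (Finset.mem_filter.1 hi).2
  -- The remaining traces have the long gap in the first component; exchanging the factors doubles
  -- the constant 4.
  have c2 := card_le_of_hasLongGap hM' hM hE' hE (T.filter fun i => ¬ P i) h g
    (fun i hi => (hT i (Finset.mem_filter.1 hi).1).swap)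
    (fun i hi i' hi' j k hs =>
      hsep i (Finset.mem_filter.1 hi).1 i' (Finset.mem_filter.1 hi').1 j k hs.symm)
    (fun i hi i' hi' he =>
      hneq i (Finset.mem_filter.1 hi).1 i' (Finset.mem_filter.1 hi').1 (by
        obtain ⟨u, v, h1, h2⟩ := he
        refine ⟨u, v, fun j => ?_, fun j k => ?_⟩
        · rw [(hT i (Finset.mem_filter.1 hi).1).label, (hT i' (Finset.mem_filter.1 hi').1).label, h1]
        · exact and_comm.trans ((h2 j k).trans and_comm)))
    (fun i hi => by
      obtain ⟨hi, hPi⟩ := Finset.mem_filter.1 hi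
      obtain ⟨N, hN, hp⟩ := (hT i hi).periodic
      exact (exists_hasLongGap hN (fun j => by rw [(hp j).1]) (fun j => by rw [(hp j).2])
        (hB i hi) (hB' i hi)).resolve_left hPi)
  rw [← Finset.card_filter_add_card_filter_not (s := T) P]
  nlinarith

end

/-! ### Cycles and the first Betti number -/

/-- The edges of a cycle. -/
def Hom.edge {G : DirGraph} {n : ℕ} (f : Hom (circle n) G) (i : Fin (n + 1)) : G.E := f.onE i

theorem Hom.t_edge {G : DirGraph} {n : ℕ} (f : Hom (circle n) G) (i : Fin (n + 1)) :
    G.t (f.edge i) = G.o (f.edge (i + 1)) :=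
  (f.map_t i).symm.trans (f.map_o (i + 1))

/-- The edge lies on a cycle. -/
def IsCoreEdge (G : DirGraph) (e : G.E) : Prop :=
  ∃ (n : ℕ) (f : Hom (circle n) G), e ∈ Set.range f.onE

/-- The cellular chain of a cycle. -/
noncomputable def cycleChain {G : DirGraph} {n : ℕ} (f : Hom (circle n) G) : G.E →₀ ℚ :=
  ∑ i, Finsupp.single (f.edge i) 1

theorem boundary_single (G : DirGraph) (e : G.E) (q : ℚ) :
    G.boundary (Finsupp.single e q) = Finsupp.single (G.t e) q - Finsupp.single (G.o e) q := by
  simp [boundary, Finsupp.lmapDomain_apply, Finsupp.mapDomain_single]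

theorem boundary_cycleChain {G : DirGraph} {n : ℕ} (f : Hom (circle n) G) :
    G.boundary (cycleChain f) = 0 := by
  simp only [cycleChain, map_sum, boundary_single, Hom.t_edge, Finset.sum_sub_distrib]
  rw [sub_eq_zero]
  exact Equiv.sum_comp (Equiv.addRight (1 : Fin (n + 1)))
    fun i => Finsupp.single (G.o (f.edge i)) (1 : ℚ)

/-- Coefficients count passages of a directed cycle, so nothing cancels. -/
theorem cycleChain_apply_ne_zero {G : DirGraph} {n : ℕ} (f : Hom (circle n) G) (e : G.E) :
    cycleChain f e ≠ 0 ↔ e ∈ Set.range f.edge := by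
  classical
  rw [cycleChain, Finsupp.finsetSum_apply]
  constructor
  · intro h
    obtain ⟨i, -, hi⟩ := Finset.exists_ne_zero_of_sum_ne_zero h
    by_contra hne
    exact hi (Finsupp.single_eq_of_ne fun h => hne ⟨i, h.symm⟩)
  · rintro ⟨i, rfl⟩
    refine ne_of_gt (Finset.sum_pos' (fun j _ => ?_) ⟨i, Finset.mem_univ i, ?_⟩)
    · rw [Finsupp.single_apply]; split_ifs <;> norm_num
    · rw [Finsupp.single_eq_same]; norm_num

theorem finiteDimensional_cycles {G : DirGraph} (h : G.betti1 ≠ ⊤) :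
    FiniteDimensional ℚ (LinearMap.ker G.boundary) ∧
      (Module.finrank ℚ (LinearMap.ker G.boundary) : ℕ∞) = G.betti1 := by
  have h1 : Module.rank ℚ (LinearMap.ker G.boundary) < Cardinal.aleph0 := by
    by_contra! h'
    exact h (Cardinal.toENat_eq_top.2 h')
  have h2 : FiniteDimensional ℚ (LinearMap.ker G.boundary) := Module.rank_lt_aleph0_iff.1 h1
  refine ⟨h2, ?_⟩
  rw [betti1, ← Module.finrank_eq_rank, Cardinal.toENat_nat]

/-- Cycles each of which has an edge that the others avoid are linearly independent. -/
theorem card_le_of_private_edges {G : DirGraph} [FiniteDimensional ℚ (LinearMap.ker G.boundary)]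
    {ι : Type*} (T : Finset ι) (n : ι → ℕ) (f : ∀ i, Hom (circle (n i)) G) (e : ι → G.E)
    (he : ∀ i ∈ T, ∀ j ∈ T, e j ∈ Set.range (f i).edge ↔ i = j) :
    T.card ≤ Module.finrank ℚ (LinearMap.ker G.boundary) := by
  classical
  have hli : LinearIndependent ℚ fun i : T =>
      (⟨cycleChain (f i), boundary_cycleChain (f i)⟩ : LinearMap.ker G.boundary) := by
    rw [Fintype.linearIndependent_iff]
    intro c hc j
    have h1 := congrArg (fun z : LinearMap.ker G.boundary => (z : G.E →₀ ℚ) (e j)) hc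
    simp only [Submodule.coe_sum, Submodule.coe_smul, Finsupp.finsetSum_apply, Finsupp.smul_apply,
      smul_eq_mul, ZeroMemClass.coe_zero, Finsupp.coe_zero, Pi.zero_apply] at h1
    rw [Finset.sum_eq_single j] at h1
    · exact (mul_eq_zero.1 h1).resolve_right
        ((cycleChain_apply_ne_zero _ _).2 ((he j j.2 j j.2).2 rfl))
    · intro i _ hij
      rw [mul_eq_zero]
      right
      by_contra h0
      exact hij (Subtype.ext ((he i i.2 j j.2).1 ((cycleChain_apply_ne_zero _ _).1 h0)))
    · intro h; exact absurd (Finset.mem_univ j) h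
  have := hli.fintype_card_le_finrank
  rwa [Fintype.card_coe] at this

/-- The Euler characteristic estimate for a finite set of edges without dead ends. -/
theorem card_le_card_add_finrank {G : DirGraph}
    [FiniteDimensional ℚ (LinearMap.ker G.boundary)] (H : Finset G.E) (W : Finset G.V)
    (ho : ∀ e ∈ H, G.o e ∈ W) (ht : ∀ e ∈ H, G.t e ∈ W) :
    H.card ≤ W.card + Module.finrank ℚ (LinearMap.ker G.boundary) := by
  classical
  let S := Finsupp.supported ℚ ℚ (H : Set G.E)
  let S' := Finsupp.supported ℚ ℚ (W : Set G.V)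
  have eS : S ≃ₗ[ℚ] (H →₀ ℚ) := Finsupp.supportedEquivFinsupp (H : Set G.E)
  have eS' : S' ≃ₗ[ℚ] (W →₀ ℚ) := Finsupp.supportedEquivFinsupp (W : Set G.V)
  have : FiniteDimensional ℚ S := Module.Finite.equiv eS.symm
  have : FiniteDimensional ℚ S' := Module.Finite.equiv eS'.symm
  have hS : Module.finrank ℚ S = H.card := by rw [eS.finrank_eq]; simp
  have hS' : Module.finrank ℚ S' = W.card := by rw [eS'.finrank_eq]; simp
  let φ := G.boundary.domRestrict S
  have hrange : LinearMap.range φ ≤ S' := by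
    rintro _ ⟨⟨x, hx⟩, rfl⟩
    change G.boundary x ∈ S'
    rw [← Finsupp.sum_single x, Finsupp.sum, map_sum]
    refine Submodule.sum_mem _ fun e he => ?_
    have heH : e ∈ H := hx he
    rw [boundary_single]
    exact Submodule.sub_mem _ (Finsupp.single_mem_supported ℚ _ (ht e heH))
      (Finsupp.single_mem_supported ℚ _ (ho e heH))
  have hker : Module.finrank ℚ (LinearMap.ker φ) ≤
      Module.finrank ℚ (LinearMap.ker G.boundary) := by
    let ψ : LinearMap.ker φ →ₗ[ℚ] LinearMap.ker G.boundary :=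
      LinearMap.codRestrict _ (S.subtype.comp (LinearMap.ker φ).subtype) fun x => x.2
    refine LinearMap.finrank_le_finrank_of_injective (f := ψ) fun x y hxy => ?_
    have h : ((ψ x : LinearMap.ker G.boundary) : G.E →₀ ℚ) = ψ y := by rw [hxy]
    exact Subtype.ext (Subtype.ext h)
  have h1 := φ.finrank_range_add_finrank_ker
  have h2 := Submodule.finrank_mono hrange
  omega

/-- If one edge of the core is distinguished at each vertex of the core, then the number of other
edges of the core is at most the first Betti number. -/
theorem card_extra_le {G : DirGraph} [FiniteDimensional ℚ (LinearMap.ker G.boundary)]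
    (d : G.V → G.E) (hd : ∀ e, G.IsCoreEdge e → G.IsCoreEdge (d (G.o e)) ∧ G.o (d (G.o e)) = G.o e)
    (N : Finset G.E) (hN : ∀ e ∈ N, G.IsCoreEdge e ∧ e ≠ d (G.o e)) :
    N.card ≤ Module.finrank ℚ (LinearMap.ker G.boundary) := by
  classical
  have hc : ∀ e, G.IsCoreEdge e → ∃ S : Finset G.E, e ∈ S ∧ ∀ e' ∈ S, G.t e' ∈ S.image G.o := by
    rintro e ⟨n, f, i, hi⟩
    refine ⟨(Finset.univ : Finset (Fin (n + 1))).image f.edge,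
      Finset.mem_image.2 ⟨i, Finset.mem_univ (α := Fin (n + 1)) i, hi⟩, fun e' he' => ?_⟩
    obtain ⟨j, -, rfl⟩ := Finset.mem_image.1 he'
    exact Finset.mem_image.2 ⟨_, Finset.mem_image_of_mem _ (Finset.mem_univ (j + 1)),
      (f.t_edge j).symm⟩
  choose! S hS hSt using hc
  -- Adding the distinguished edges at the origins of `N` lets `H \ N` keep all origins of `H`.
  -- Since `H` is a union of cycles, its targets are among these origins.
  set N' := N ∪ N.image fun e => d (G.o e)
  set H : Finset G.E := N'.biUnion S
  have hcore : ∀ e ∈ N', G.IsCoreEdge e := by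
    intro e he
    rcases Finset.mem_union.1 he with he | he
    · exact (hN e he).1
    · obtain ⟨e', he', rfl⟩ := Finset.mem_image.1 he
      exact (hd e' (hN e' he').1).1
  have hsub : ∀ e ∈ N', e ∈ H := fun e he => Finset.mem_biUnion.2 ⟨e, he, hS e (hcore e he)⟩
  have hmain := card_le_card_add_finrank H (H.image G.o)
    (fun e he => Finset.mem_image_of_mem _ he) fun e he => by
      obtain ⟨e', he', hi⟩ := Finset.mem_biUnion.1 he
      exact Finset.image_subset_image (Finset.subset_biUnion_of_mem S he')
        (hSt e' (hcore e' he') e hi)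
  have hsplit : N.card + (H.image G.o).card ≤ H.card := by
    have himg : H.image G.o = (H \ N).image G.o := by
      refine Finset.Subset.antisymm (fun v hv => ?_) (Finset.image_subset_image Finset.sdiff_subset)
      obtain ⟨e, he, rfl⟩ := Finset.mem_image.1 hv
      by_cases heN : e ∈ N
      · have h1 := (hd e (hN e heN).1).2
        refine Finset.mem_image.2 ⟨d (G.o e), Finset.mem_sdiff.2 ⟨hsub _ (Finset.mem_union_right _
          (Finset.mem_image_of_mem _ heN)), fun h => (hN _ h).2 ?_⟩, h1⟩
        rw [h1]
      · exact Finset.mem_image_of_mem _ (Finset.mem_sdiff.2 ⟨he, heN⟩)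
    have hNH : N ⊆ H := fun e he => hsub e (Finset.mem_union_left _ he)
    have := Finset.card_sdiff_add_card_eq_card hNH
    have := Finset.card_image_le (s := H \ N) (f := G.o)
    rw [himg]
    omega
  omega

/-! ### Construction of the marking -/

theorem exists_finset_of_card_le {α : Type*} (P : α → Prop) (m : ℕ)
    (h : ∀ T : Finset α, (∀ a ∈ T, P a) → T.card ≤ m) :
    ∃ U : Finset α, U.card ≤ m ∧ ∀ a, a ∈ U ↔ P a := by
  have hfin : {a | P a}.Finite := by
    by_contra hinf
    obtain ⟨T, hT, hc⟩ := Set.Infinite.exists_subset_card_eq hinf (m + 1)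
    have := h T fun a ha => hT ha
    omega
  exact ⟨hfin.toFinset, h _ fun a ha => (hfin.mem_toFinset).1 ha, fun a => hfin.mem_toFinset⟩

theorem Hom.isTrack {G : DirGraph} {n : ℕ} (f : Hom (circle n) G) {C : G.E → Prop}
    (hC : ∀ i, C (f.edge i)) (i : Fin (n + 1)) : IsTrack C fun k : ℕ => f.edge (i + k • (1 : Fin (n + 1))) :=
  ⟨fun _ => hC _, fun k => by rw [Hom.t_edge, succ_nsmul, add_assoc]⟩

/-- A cycle agrees with a deterministic track through one of its vertices. -/
theorem Hom.eq_track {G : DirGraph} {n : ℕ} (f : Hom (circle n) G) {C : G.E → Prop}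
    (hC : ∀ i, C (f.edge i)) {g : ℕ → G.E} (hg : IsTrack C g) (i : Fin (n + 1))
    (h0 : G.o (g 0) = G.o (f.edge i)) (hu : ∀ k e, C e → G.o e = G.o (g k) → e = g k) (k : ℕ) :
    f.edge (i + k • (1 : Fin (n + 1))) = g k := by
  induction k with
  | zero =>
    refine hu 0 _ (hC _) ?_
    rw [h0, zero_nsmul, add_zero]
  | succ k ih =>
    refine hu (k + 1) _ (hC _) ?_
    rw [← hg.next, ← ih]
    exact ((f.isTrack hC i).next k).symm

theorem exists_eq_add_nsmul {n : ℕ} (i j : Fin (n + 1)) : ∃ k : ℕ, j = i + k • (1 : Fin (n + 1)) :=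
  by
  have h : ∀ k : ℕ, (k • (1 : Fin (n + 1))).val = k % (n + 1) := by
    intro k
    induction k with
    | zero => simp
    | succ k ih => rw [succ_nsmul, Fin.val_add, ih, Fin.val_one', Nat.add_mod_mod, Nat.mod_add_mod]
  refine ⟨(j - i).val, ?_⟩
  have h1 : (j - i).val • (1 : Fin (n + 1)) = j - i :=
    Fin.ext ((h _).trans (Nat.mod_eq_of_lt (j - i).isLt))
  rw [h1, add_sub_cancel]

theorem isCoreEdge_edge {G : DirGraph} {n : ℕ} (f : Hom (circle n) G) (i : Fin (n + 1)) :
    G.IsCoreEdge (f.edge i) := ⟨n, f, i, rfl⟩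

/-- A marking of the core of a graph whose size is linear in the first Betti number. -/
theorem exists_marking {G : DirGraph} [FiniteDimensional ℚ (LinearMap.ker G.boundary)] :
    ∃ (B : Finset G.V) (E : Finset G.E),
      B.card ≤ 2 * Module.finrank ℚ (LinearMap.ker G.boundary) ∧
      E.card ≤ 3 * Module.finrank ℚ (LinearMap.ker G.boundary) ∧
      (∀ e, G.IsCoreEdge e → G.o e ∈ B → e ∈ E) ∧
      (∀ e e', G.IsCoreEdge e → G.IsCoreEdge e' → G.o e = G.o e' → G.o e ∉ B → e = e') ∧
      ∀ (n : ℕ) (f : Hom (circle n) G), ∃ i, G.o (f.edge i) ∈ B := by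
  classical
  rcases isEmpty_or_nonempty G.E with hE | hne
  · exact ⟨∅, ∅, by simp, by simp, fun e => hE.elim e, fun e => hE.elim e,
      fun n f => hE.elim (f.edge 0)⟩
  set m := Module.finrank ℚ (LinearMap.ker G.boundary)
  obtain ⟨d, hd⟩ : ∃ d : G.V → G.E, ∀ e, G.IsCoreEdge e →
      G.IsCoreEdge (d (G.o e)) ∧ G.o (d (G.o e)) = G.o e := by
    have : ∀ v, ∃ e', ∀ e, G.IsCoreEdge e → G.o e = v → G.IsCoreEdge e' ∧ G.o e' = v := by
      intro v
      by_cases hv : ∃ e, G.IsCoreEdge e ∧ G.o e = v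
      · obtain ⟨e, he⟩ := hv
        exact ⟨e, fun _ _ _ => he⟩
      · exact ⟨hne.some, fun e h1 h2 => absurd ⟨e, h1, h2⟩ hv⟩
    choose d hd using this
    exact ⟨d, fun e he => hd _ e he rfl⟩
  obtain ⟨X, hXc, hX⟩ := exists_finset_of_card_le (fun e => G.IsCoreEdge e ∧ e ≠ d (G.o e)) m
    fun T hT => card_extra_le d hd T hT
  have huniq : ∀ e, G.IsCoreEdge e → G.o e ∉ X.image G.o → e = d (G.o e) := by
    intro e he ho
    by_contra hne
    exact ho (Finset.mem_image_of_mem _ ((hX e).2 ⟨he, hne⟩))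
  -- A cycle without branch vertices cannot be left, so any cycle that meets it stays on it.
  have hshare : ∀ (n n' : ℕ) (f : Hom (circle n) G) (f' : Hom (circle n') G)
      (i : Fin (n + 1)) (i' : Fin (n' + 1)), (∀ j, G.o (f.edge j) ∉ X.image G.o) →
      G.o (f.edge i) = G.o (f'.edge i') → ∀ j', ∃ j, G.o (f'.edge j') = G.o (f.edge j) := by
    intro n n' f f' i i' hf hii j'
    obtain ⟨k, rfl⟩ := exists_eq_add_nsmul i' j'
    have hu : ∀ (k : ℕ) e, G.IsCoreEdge e → G.o e = G.o (f.edge (i + k • (1 : Fin (n + 1)))) →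
        e = f.edge (i + k • (1 : Fin (n + 1))) := by
      intro k e he ho
      have h1 : G.o (f.edge (i + k • (1 : Fin (n + 1)))) ∉ X.image G.o := by
        exact hf _
      rw [huniq e he (ho ▸ h1), ho, ← huniq _ (isCoreEdge_edge f _) h1]
    have := f'.eq_track (isCoreEdge_edge f') (f.isTrack (isCoreEdge_edge f) i) i' (by
      rw [← hii, zero_nsmul, add_zero]) hu k
    exact ⟨i + k • (1 : Fin (n + 1)), congrArg G.o this⟩
  -- These points lie on cycles without branch vertices, one point on each. The edges `d w` are
  -- private to them, so there are at most `m` points.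
  let Q : Finset G.V → Prop := fun T => ∀ w ∈ T, ∃ (n : ℕ) (f : Hom (circle n) G),
    (∀ j, G.o (f.edge j) ∉ X.image G.o) ∧ ∀ w' ∈ T, w' ∈ Set.range (G.o ∘ f.edge) ↔ w = w'
  have hQm : ∀ T, Q T → T.card ≤ m := by
    intro T hT
    have : ∀ w : T, ∃ (n : ℕ) (f : Hom (circle n) G),
      (∀ j, G.o (f.edge j) ∉ X.image G.o) ∧ ∀ w' ∈ T, w' ∈ Set.range (G.o ∘ f.edge) ↔ (w : G.V) = w' :=
        fun w => hT w w.2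
    choose n f hf hw using this
    rw [← Finset.card_attach]
    refine card_le_of_private_edges T.attach n f (fun w => d w) fun w _ w' _ => ?_
    have hE : ∀ j, (f w).edge j = d (G.o ((f w).edge j)) := fun j =>
      huniq _ (isCoreEdge_edge (f w) j) (hf w j)
    rw [Subtype.ext_iff, ← hw w w' w'.2]
    constructor
    · rintro ⟨j, hj⟩
      obtain ⟨i, hi⟩ := (hw w' w' w'.2).2 rfl
      have h1 : G.o (d w') = w' := by
        rw [← hi]
        exact (hd _ (isCoreEdge_edge (f w') i)).2
      exact ⟨j, by rw [Function.comp_apply, hj, h1]⟩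
    · rintro ⟨j, hj⟩
      exact ⟨j, by rw [hE, ← hj, Function.comp_apply]⟩
  obtain ⟨T, hT, hTmax⟩ : ∃ T, Q T ∧ ∀ T', Q T' → T'.card ≤ T.card := by
    have h0 : Q ∅ := fun w hw => absurd hw (Finset.notMem_empty w)
    obtain ⟨T, hT, hc⟩ := Nat.findGreatest_spec (P := fun k => ∃ T, Q T ∧ T.card = k)
      (Nat.zero_le m) ⟨∅, h0, rfl⟩
    exact ⟨T, hT, fun T' hT' => hc ▸ Nat.le_findGreatest (hQm T' hT') ⟨T', hT', rfl⟩⟩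
  -- Branch vertices and a maximal `T` give 2m vertices; the extra edges and one distinguished edge
  -- per marked vertex give 3m edges.
  refine ⟨X.image G.o ∪ T, X ∪ (X.image G.o ∪ T).image d, ?_, ?_, ?_, ?_, ?_⟩
  · have h1 := Finset.card_union_le (X.image G.o) T
    have h2 := Finset.card_image_le (s := X) (f := G.o)
    have h3 := hQm T hT
    omega
  · have h0 := Finset.card_union_le X ((X.image G.o ∪ T).image d)
    have h1 := Finset.card_union_le (X.image G.o) T
    have h2 := Finset.card_image_le (s := X) (f := G.o)
    have h3 := hQm T hT
    have h4 := Finset.card_image_le (s := X.image G.o ∪ T) (f := d)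
    omega
  · intro e he ho
    by_cases h : e = d (G.o e)
    · rw [h]
      exact Finset.mem_union_right _ (Finset.mem_image_of_mem _ ho)
    · exact Finset.mem_union_left _ ((hX e).2 ⟨he, h⟩)
  · intro e e' he he' hee ho
    have h1 : G.o e ∉ X.image G.o := fun h => ho (Finset.mem_union_left _ h)
    rw [huniq e he h1, huniq e' he' (hee ▸ h1), hee]
  · intro n f
    by_contra! hf
    have hfX : ∀ j, G.o (f.edge j) ∉ X.image G.o := fun j h => hf j (Finset.mem_union_left _ h)
    have hfT : ∀ j, G.o (f.edge j) ∉ T := fun j h => hf j (Finset.mem_union_right _ h)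
    -- A cycle missing the marking would contribute a new point, against the maximality of `T`.
    have hins : Q (insert (G.o (f.edge 0)) T) := by
      intro w hw
      rcases Finset.mem_insert.1 hw with rfl | hw
      · refine ⟨n, f, hfX, fun w' hw' => ?_⟩
        rcases Finset.mem_insert.1 hw' with rfl | hw'
        · exact ⟨fun _ => rfl, fun _ => ⟨_, rfl⟩⟩
        · constructor
          · rintro ⟨j, rfl⟩; exact absurd hw' (hfT j)
          · rintro rfl; exact absurd hw' (hfT _)
      · obtain ⟨n', f', h1, h2⟩ := hT w hw
        refine ⟨n', f', h1, fun w' hw' => ?_⟩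
        rcases Finset.mem_insert.1 hw' with rfl | hw'
        · constructor
          · rintro ⟨j, hj⟩
            obtain ⟨i, hi⟩ := (h2 w hw).2 rfl
            obtain ⟨j', hj'⟩ := hshare _ _ f f' 0 j hfX hj.symm i
            exact absurd hw (by rw [← hi, Function.comp_apply, hj']; exact hfT j')
          · rintro rfl; exact absurd hw (hfT _)
        · exact h2 w' hw'
    have := hTmax _ hins
    rw [Finset.card_insert_of_notMem (hfT _)] at this
    omega

/-! ### Isomorphisms over the base -/

theorem Hom.ext_maps {G H : DirGraph} {f g : Hom G H} (hV : ∀ v, f.onV v = g.onV v)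
    (hE : ∀ e, f.onE e = g.onE e) : f = g := by
  cases f; cases g
  simp only [Hom.mk.injEq]
  exact ⟨funext hV, funext hE⟩

/-- The identity graph map. -/
def Hom.id (G : DirGraph) : Hom G G := ⟨fun v => v, fun e => e, fun _ => rfl, fun _ => rfl⟩

theorem Hom.realize_comp {G H K : DirGraph} (g : Hom H K) (f : Hom G H) :
    (g.comp f).realize = g.realize.comp f.realize := by
  ext x
  induction x using Quot.ind with
  | mk a => rcases a with v | ⟨e, s⟩ <;> rfl

theorem Hom.realize_id (G : DirGraph) : (Hom.id G).realize = ContinuousMap.id G.Realization := by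
  ext x
  induction x using Quot.ind with
  | mk a => rcases a with v | ⟨e, s⟩ <;> rfl

/-- An isomorphism of graphs over `D` is a free homotopy. -/
theorem Hom.freelyHomotopic_of_iso {X Y D : DirGraph} {f : Hom X D} {g : Hom Y D} (φ : Hom X Y)
    (ψ : Hom Y X) (h1 : ψ.comp φ = Hom.id X) (h2 : φ.comp ψ = Hom.id Y) (h : g.comp φ = f) :
    f.FreelyHomotopic g := by
  refine ⟨⟨φ.realize, ψ.realize, ?_, ?_⟩, ?_⟩
  · rw [← Hom.realize_comp, h1, Hom.realize_id]
  · rw [← Hom.realize_comp, h2, Hom.realize_id]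
  · rw [← Hom.realize_comp, h]

/-- The tracks cover `X`, and the coincidences make `a j ↦ b j` well defined. -/
theorem exists_hom_of_tracks {X Y : DirGraph} (a : ℕ → X.E) (b : ℕ → Y.E)
    (ha : ∀ e, ∃ j, a j = e) (ha' : ∀ v, ∃ j, X.o (a j) = v)
    (hat : ∀ j, X.t (a j) = X.o (a (j + 1))) (hbt : ∀ j, Y.t (b j) = Y.o (b (j + 1)))
    (hE : ∀ j k, a j = a k → b j = b k)
    (hV : ∀ j k, X.o (a j) = X.o (a k) → Y.o (b j) = Y.o (b k)) :
    ∃ φ : Hom X Y, (∀ j, φ.onE (a j) = b j) ∧ ∀ j, φ.onV (X.o (a j)) = Y.o (b j) := by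
  choose p hp using ha
  choose q hq using ha'
  have h1 : ∀ j, b (p (a j)) = b j := fun j => hE _ _ (hp _)
  have h2 : ∀ j, Y.o (b (q (X.o (a j)))) = Y.o (b j) := fun j => hV _ _ (hq _)
  refine ⟨⟨fun v => Y.o (b (q v)), fun e => b (p e), fun e => ?_, fun e => ?_⟩, h1, h2⟩
  · obtain ⟨j, rfl⟩ : ∃ j, a j = e := ⟨_, hp e⟩
    rw [h1, h2]
  · obtain ⟨j, rfl⟩ : ∃ j, a j = e := ⟨_, hp e⟩
    rw [h1, hat, h2, hbt]

/-- Two graphs over `D` which are traversed by edge sequences with the same labels and the same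
coincidences are freely homotopic over `D`. -/
theorem Hom.freelyHomotopic_of_tracks {X Y D : DirGraph} {f : Hom X D} {g : Hom Y D}
    (a : ℕ → X.E) (b : ℕ → Y.E)
    (ha : ∀ e, ∃ j, a j = e) (ha' : ∀ v, ∃ j, X.o (a j) = v)
    (hb : ∀ e, ∃ j, b j = e) (hb' : ∀ v, ∃ j, Y.o (b j) = v)
    (hat : ∀ j, X.t (a j) = X.o (a (j + 1))) (hbt : ∀ j, Y.t (b j) = Y.o (b (j + 1)))
    (hE : ∀ j k, a j = a k ↔ b j = b k)
    (hV : ∀ j k, X.o (a j) = X.o (a k) ↔ Y.o (b j) = Y.o (b k))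
    (hD : ∀ j, f.onE (a j) = g.onE (b j)) : f.FreelyHomotopic g := by
  obtain ⟨φ, hφE, hφV⟩ := exists_hom_of_tracks a b ha ha' hat hbt (fun j k => (hE j k).1)
    fun j k => (hV j k).1
  obtain ⟨ψ, hψE, hψV⟩ := exists_hom_of_tracks b a hb hb' hbt hat (fun j k => (hE j k).2)
    fun j k => (hV j k).2
  refine Hom.freelyHomotopic_of_iso φ ψ (Hom.ext_maps ?_ ?_) (Hom.ext_maps ?_ ?_)
    (Hom.ext_maps ?_ ?_)
  · intro v
    obtain ⟨j, rfl⟩ := ha' v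
    exact (congrArg ψ.onV (hφV j)).trans (hψV j)
  · intro e
    obtain ⟨j, rfl⟩ := ha e
    exact (congrArg ψ.onE (hφE j)).trans (hψE j)
  · intro v
    obtain ⟨j, rfl⟩ := hb' v
    exact (congrArg φ.onV (hψV j)).trans (hφV j)
  · intro e
    obtain ⟨j, rfl⟩ := hb e
    exact (congrArg φ.onE (hψE j)).trans (hφE j)
  · intro v
    obtain ⟨j, rfl⟩ := ha' v
    refine (congrArg g.onV (hφV j)).trans ?_
    rw [g.map_o, f.map_o, hD]
  · intro e
    obtain ⟨j, rfl⟩ := ha e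
    exact (congrArg g.onE (hφE j)).trans (hD j).symm

/-! ### Components in which every continuation is forced -/

/-- The projection of the fibre product to its second factor. -/
def fibreProduct.snd {G L D : DirGraph} (γ : Hom G D) (l : Hom L D) :
    Hom (fibreProduct γ l) L where
  onV p := p.1.2
  onE p := p.1.2
  map_o _ := rfl
  map_t _ := rfl

theorem IsCoreEdge.map {G H : DirGraph} {e : G.E} (he : G.IsCoreEdge e) (f : Hom G H) :
    H.IsCoreEdge (f.onE e) := by
  obtain ⟨n, c, i, rfl⟩ := he
  exact ⟨n, f.comp c, i, rfl⟩

/-- Every vertex of the core lies on a cycle in the core. -/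
theorem exists_circle_in_core {G : DirGraph} (v : (core G).V) :
    ∃ (n : ℕ) (f : Hom (circle n) (core G)) (i : Fin (n + 1)), (core G).o (f.edge i) = v := by
  obtain ⟨v, n, f, i, rfl⟩ := v
  refine ⟨n, ⟨fun j => ⟨f.onV j, n, f, j, rfl⟩, fun j => ⟨f.onE j, n, f, j, rfl⟩,
    fun j => Subtype.ext (f.map_o j), fun j => Subtype.ext (f.map_t j)⟩, i, ?_⟩
  exact Subtype.ext (f.map_o i).symm

section

variable {K : DirGraph} (out : K.V → K.E)

/-- The vertices of the path that follows the distinguished edges. -/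
def follow (v : K.V) (k : ℕ) : K.V := (fun w => K.t (out w))^[k] v

variable {out}

theorem follow_succ (v : K.V) (k : ℕ) : follow out v (k + 1) = K.t (out (follow out v k)) :=
  Function.iterate_succ_apply' _ _ _

theorem follow_add (v : K.V) (j k : ℕ) : follow out v (j + k) = follow out (follow out v j) k := by
  rw [add_comm]
  exact Function.iterate_add_apply _ _ _ _

variable (hout : ∀ v, K.o (out v) = v)

include hout

theorem isTrack_follow (v : K.V) : IsTrack (fun _ => True) fun k => out (follow out v k) :=
  ⟨fun _ => trivial, fun k => by rw [hout, follow_succ]⟩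

theorem toPi0_follow (v : K.V) (k : ℕ) : K.toPi0 (follow out v k) = K.toPi0 v := by
  induction k with
  | zero => rfl
  | succ k ih => rw [follow_succ, toPi0_t, hout, ih]

variable {v : K.V} (huniq : ∀ e, K.toPi0 (K.o e) = K.toPi0 v → e = out (K.o e))

include huniq

theorem follow_eq_edge {n : ℕ} (f : Hom (circle n) K) (i : Fin (n + 1)) (hi : K.o (f.edge i) = v)
    (k : ℕ) : f.edge (i + k • (1 : Fin (n + 1))) = out (follow out v k) := by
  refine f.eq_track (C := fun _ => True) (fun _ => trivial) (isTrack_follow hout v) i ?_ ?_ k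
  · rw [hout, hi]; rfl
  · intro k e _ he
    rw [hout] at he
    rw [← he]
    exact huniq e (by rw [he, toPi0_follow hout])

/-- The path has to run around the cycle through `v`, whose length is then a period. -/
theorem follow_periodic (hcirc : ∃ (n : ℕ) (f : Hom (circle n) K) (i : Fin (n + 1)),
    K.o (f.edge i) = v) : ∃ N, 0 < N ∧ ∀ k, follow out v (k + N) = follow out v k := by
  obtain ⟨n, f, i, hi⟩ := hcirc
  refine ⟨n + 1, n.succ_pos, fun k => ?_⟩
  have h : (n + 1) • (1 : Fin (n + 1)) = 0 := by
    simpa using card_nsmul_eq_zero' (G := Fin (n + 1)) (x := 1)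
  rw [← hout (follow out v (k + (n + 1))), ← hout (follow out v k),
    ← follow_eq_edge hout huniq f i hi, ← follow_eq_edge hout huniq f i hi, add_nsmul, h, add_zero]

/-- The path visits the whole component. -/
theorem exists_follow_eq (hcirc : ∀ v, ∃ (n : ℕ) (f : Hom (circle n) K) (i : Fin (n + 1)),
    K.o (f.edge i) = v) {w : K.V} (hw : K.toPi0 w = K.toPi0 v) : ∃ k, follow out v k = w := by
  have hrel := Quot.eqvGen_exact hw
  have hP : ∀ w w', Relation.EqvGen (fun u v : K.V => ∃ e : K.E, K.o e = u ∧ K.t e = v) w w' →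
      K.toPi0 w = K.toPi0 v → (∃ k, follow out w k = w') ∧ ∃ k, follow out w' k = w := by
    intro w w' h
    -- By periodicity the path returns to its start, so reachability is symmetric and coincides with
    -- the relation generated by the edges.
    have hback : ∀ w w' k, K.toPi0 w = K.toPi0 v → follow out w k = w' →
        ∃ k, follow out w' k = w := by
      rintro w _ k hw rfl
      obtain ⟨N, hN, hp⟩ := follow_periodic hout (v := w) (fun e he => huniq e (he.trans hw))
        (hcirc w)
      have hpm : ∀ q, follow out w (q * N) = w := by
        intro q
        induction q with
        | zero => rw [zero_mul]; rfl
        | succ q ih => rw [Nat.succ_mul, hp, ih]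
      have hk : k ≤ k * N := Nat.le_mul_of_pos_right k hN
      exact ⟨k * N - k, by rw [← follow_add, Nat.add_sub_cancel' hk, hpm]⟩
    induction h with
    | rel x y h =>
      intro hx
      obtain ⟨e, rfl, rfl⟩ := h
      have h1 : follow out (K.o e) 1 = K.t e := by
        change K.t (out (K.o e)) = _
        rw [← huniq e hx]
      exact ⟨⟨1, h1⟩, hback _ _ 1 hx h1⟩
    | refl x => exact fun _ => ⟨⟨0, rfl⟩, ⟨0, rfl⟩⟩
    | symm x y h ih =>
      intro hy
      exact (ih ((Quot.eqvGen_sound h).trans hy)).symm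
    | trans x y z h1 h2 ih1 ih2 =>
      intro hx
      obtain ⟨⟨a, ha⟩, ⟨b, hb⟩⟩ := ih1 hx
      obtain ⟨⟨c, hc⟩, ⟨d, hd⟩⟩ := ih2 ((Quot.eqvGen_sound h1).symm.trans hx)
      exact ⟨⟨a + c, by rw [follow_add, ha, hc]⟩, ⟨d + b, by rw [follow_add, hd, hb]⟩⟩
  exact (hP w v hrel hw).2

end

/-! ### Components of the core of the fibre product -/

section

variable {G L D : DirGraph} {γ : Hom G D} {l : Hom L D}

/-- The edge of the first factor under an edge of the core of a fibre product. -/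
def fstEdge (e : (core (fibreProduct γ l)).E) : G.E := e.1.1.1

/-- The edge of the second factor under an edge of the core of a fibre product. -/
def sndEdge (e : (core (fibreProduct γ l)).E) : L.E := e.1.1.2

theorem isCoreEdge_fstEdge (e : (core (fibreProduct γ l)).E) : G.IsCoreEdge (fstEdge e) :=
  IsCoreEdge.map (G := fibreProduct γ l) e.2 (fibreProduct.fst γ l)

theorem isCoreEdge_sndEdge (e : (core (fibreProduct γ l)).E) : L.IsCoreEdge (sndEdge e) :=
  IsCoreEdge.map (G := fibreProduct γ l) e.2 (fibreProduct.snd γ l)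

theorem fstEdge_label (e : (core (fibreProduct γ l)).E) :
    γ.onE (fstEdge e) = l.onE (sndEdge e) := e.1.2

theorem core_edge_ext {e e' : (core (fibreProduct γ l)).E} (h1 : fstEdge e = fstEdge e')
    (h2 : sndEdge e = sndEdge e') : e = e' :=
  Subtype.ext (Subtype.ext (Prod.ext h1 h2))

theorem sameState_iff (e e' : (core (fibreProduct γ l)).E) :
    SameState (fstEdge e) (fstEdge e') (sndEdge e) (sndEdge e') ↔
      (core (fibreProduct γ l)).o e = (core (fibreProduct γ l)).o e' :=
  ⟨fun h => Subtype.ext (Subtype.ext (Prod.ext h.1 h.2)), fun h =>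
    ⟨congrArg (fun v => v.1.1.1) h, congrArg (fun v => v.1.1.2) h⟩⟩

theorem Hom.IsForwardsImmersion.isMarking (hγ : γ.IsForwardsImmersion) {B : Finset G.V}
    (hB : ∀ e e', G.IsCoreEdge e → G.IsCoreEdge e' → G.o e = G.o e' → G.o e ∉ B → e = e') :
    IsMarking G.IsCoreEdge γ.onE B :=
  ⟨fun e _ _ _ ho hl => hγ (G.o e) rfl ho.symm hl, hB⟩

/-- Components of the core of the fibre product on which at most one of the two current vertices
is marked at any time. -/
def IsUnmarked (γ : Hom G D) (l : Hom L D) (B : Finset G.V) (B' : Finset L.V)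
    (c : (core (fibreProduct γ l)).Pi0) : Prop :=
  ∀ v : (core (fibreProduct γ l)).V, toPi0 _ v = c → ¬ (v.1.1.1 ∈ B ∧ v.1.1.2 ∈ B')

/-- An unmarked coordinate has only one core edge to follow; its label then determines the edge in
the other coordinate. -/
theorem IsUnmarked.edge_eq {B : Finset G.V} {B' : Finset L.V} (hM : IsMarking G.IsCoreEdge γ.onE B)
    (hM' : IsMarking L.IsCoreEdge l.onE B') {e e' : (core (fibreProduct γ l)).E}
    (hc : IsUnmarked γ l B B' (toPi0 _ ((core (fibreProduct γ l)).o e)))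
    (h : (core (fibreProduct γ l)).o e = (core (fibreProduct γ l)).o e') : e = e' := by
  obtain ⟨h1, h2⟩ := (sameState_iff e e').2 h
  by_cases hB : G.o (fstEdge e) ∈ B
  · have hs := hM'.unique _ _ (isCoreEdge_sndEdge e) (isCoreEdge_sndEdge e') h2
      fun h' => hc _ rfl ⟨hB, h'⟩
    refine core_edge_ext (hM.det _ _ (isCoreEdge_fstEdge e) (isCoreEdge_fstEdge e') h1 ?_) hs
    rw [fstEdge_label, fstEdge_label, hs]
  · have hf := hM.unique _ _ (isCoreEdge_fstEdge e) (isCoreEdge_fstEdge e') h1 hB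
    refine core_edge_ext hf (hM'.det _ _ (isCoreEdge_sndEdge e) (isCoreEdge_sndEdge e') h2 ?_)
    rw [← fstEdge_label, ← fstEdge_label, hf]

/-- A finite set of pairwise inequivalent components of the core of the fibre product. -/
theorem card_components_le {B : Finset G.V} {B' : Finset L.V}
    (hM : IsMarking G.IsCoreEdge γ.onE B) (hM' : IsMarking L.IsCoreEdge l.onE B')
    {E : Finset G.E} {E' : Finset L.E}
    (hE : ∀ e, G.IsCoreEdge e → G.o e ∈ B → e ∈ E) (hE' : ∀ e, L.IsCoreEdge e → L.o e ∈ B' → e ∈ E')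
    (hB : ∀ (n : ℕ) (f : Hom (circle n) G), ∃ i, G.o (f.edge i) ∈ B)
    (hB' : ∀ (n : ℕ) (f : Hom (circle n) L), ∃ i, L.o (f.edge i) ∈ B')
    (T : Finset (core (fibreProduct γ l)).Pi0)
    (hT : ∀ c ∈ T, ∀ c' ∈ T, (coreToBase γ l).componentSetoid c c' → c = c') :
    T.card ≤ ((B.card + 1) * (B'.card + 1) + 1) * (E.card * E'.card * 8) + B.card * B'.card := by
  classical
  let K := core (fibreProduct γ l)
  have hcirc : ∀ v : K.V, ∃ (n : ℕ) (f : Hom (circle n) K) (i : Fin (n + 1)),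
      K.o (f.edge i) = v := exists_circle_in_core
  obtain ⟨out, hout⟩ : ∃ out : K.V → K.E, ∀ v, K.o (out v) = v := by
    have : ∀ v : K.V, ∃ e, K.o e = v := fun v => by
      obtain ⟨n, f, i, h⟩ := hcirc v
      exact ⟨_, h⟩
    choose out hout using this
    exact ⟨out, hout⟩
  obtain ⟨rep, hrep⟩ : ∃ rep : K.Pi0 → K.V, ∀ c, K.toPi0 (rep c) = c := by
    have : ∀ c : K.Pi0, ∃ v, K.toPi0 v = c := Quot.exists_rep
    choose rep hrep using this
    exact ⟨rep, hrep⟩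
  set U : K.Pi0 → Prop := IsUnmarked γ l B B' with hU
  have huniq : ∀ v, U (K.toPi0 v) → ∀ e, K.toPi0 (K.o e) = K.toPi0 v → e = out (K.o e) :=
    fun v hv e he => IsUnmarked.edge_eq hM hM' (by rw [he]; exact hv) (hout _).symm
  have hUrep : ∀ c, U c → U (K.toPi0 (rep c)) := fun c hc => by rwa [hrep]
  let a : K.Pi0 → ℕ → K.E := fun c k => out (follow out (rep c) k)
  have ha : ∀ c k, K.o (a c k) = follow out (rep c) k := fun c k => hout _
  have hacomp : ∀ c k, K.toPi0 (K.o (a c k)) = c := fun c k => by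
    rw [ha, toPi0_follow hout, hrep]
  have hanext : ∀ c k, K.t (a c k) = K.o (a c (k + 1)) := fun c k =>
    (isTrack_follow hout (rep c)).next k
  have hadet : ∀ c j k, K.o (a c j) = K.o (a c k) → a c j = a c k := fun c j k h => by
    rw [ha, ha] at h
    exact congrArg out h
  have hitrace : ∀ c, U c → IsTrace G.IsCoreEdge L.IsCoreEdge γ.onE l.onE
      (fun k => fstEdge (a c k)) fun k => sndEdge (a c k) := by
    intro c hc
    refine ⟨⟨fun k => isCoreEdge_fstEdge _, fun k => ?_⟩, ⟨fun k => isCoreEdge_sndEdge _, fun k => ?_⟩,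
      fun k => fstEdge_label _, ?_, fun j k hs => ?_⟩
    · exact congrArg (fun v => v.1.1.1) (hanext c k)
    · exact congrArg (fun v => v.1.1.2) (hanext c k)
    · obtain ⟨N, hN, hp⟩ := follow_periodic hout (huniq _ (hUrep c hc)) (hcirc (rep c))
      have hp' : ∀ k, a c (k + N) = a c k := fun k => congrArg out (hp k)
      exact ⟨N, hN, fun k => by rw [hp']; exact ⟨rfl, rfl⟩⟩
    · rw [hadet c j k ((sameState_iff _ _).1 hs)]
      exact ⟨rfl, rfl⟩
  have hvisit : ∀ c, U c → ∀ (n : ℕ) (f : Hom (circle n) K) (i : Fin (n + 1)),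
      K.o (f.edge i) = rep c → ∀ j, ∃ k, f.edge j = a c k := by
    intro c hc n f i hi j
    obtain ⟨k, rfl⟩ := exists_eq_add_nsmul i j
    exact ⟨k, follow_eq_edge hout (huniq _ (hUrep c hc)) f i hi k⟩
  have c1 := card_traces_le hM hM' hE hE' (T.filter U) (fun c k => fstEdge (a c k))
    (fun c k => sndEdge (a c k)) (fun c hc => hitrace c (Finset.mem_filter.1 hc).2)
    (fun c _ c' _ j k hs => by
      rw [← hacomp c j, ← hacomp c' k, (sameState_iff _ _).1 hs])
    (fun c hc c' hc' he => by
      obtain ⟨hcT, hcU⟩ := Finset.mem_filter.1 hc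
      obtain ⟨hcT', hcU'⟩ := Finset.mem_filter.1 hc'
      refine hT c hcT c' hcT' ?_
      obtain ⟨u, v, h1, h2⟩ := he
      -- Even a tail of the path visits the whole component, so the shifts in `TraceEquiv` do no
      -- harm.
      have honto : ∀ c, U c → ∀ u w, K.toPi0 w = c → ∃ j, K.o (a c (u + j)) = w := by
        intro c hc u w hw
        have h3 : K.toPi0 (follow out (rep c) u) = c := by rw [toPi0_follow hout, hrep]
        obtain ⟨j, hj⟩ := exists_follow_eq hout (v := follow out (rep c) u)
          (huniq _ (by rwa [h3])) hcirc (hw.trans h3.symm)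
        exact ⟨j, by rw [ha, follow_add, hj]⟩
      have hontoE : ∀ c, U c → ∀ u e, K.toPi0 (K.o e) = c → ∃ j, a c (u + j) = e := by
        intro c hc u e he
        obtain ⟨j, hj⟩ := honto c hc u _ he
        refine ⟨j, ?_⟩
        rw [huniq (rep c) (hUrep c hc) e (he.trans (hrep c).symm), ← hj, ha]
      have hV : ∀ j k, K.o (a c (u + j)) = K.o (a c (u + k)) ↔
          K.o (a c' (v + j)) = K.o (a c' (v + k)) := fun j k =>
        (sameState_iff _ _).symm.trans ((h2 j k).trans (sameState_iff _ _))
      refine Hom.freelyHomotopic_of_tracks (X := K.component c) (Y := K.component c')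
        (fun j => ⟨a c (u + j), hacomp _ _⟩) (fun j => ⟨a c' (v + j), hacomp _ _⟩)
        ?_ ?_ ?_ ?_ ?_ ?_ ?_ ?_ ?_
      · rintro ⟨e, he⟩
        exact (hontoE c hcU u e he).imp fun j hj => Subtype.ext hj
      · rintro ⟨w, hw⟩
        exact (honto c hcU u w hw).imp fun j hj => Subtype.ext hj
      · rintro ⟨e, he⟩
        exact (hontoE c' hcU' v e he).imp fun j hj => Subtype.ext hj
      · rintro ⟨w, hw⟩
        exact (honto c' hcU' v w hw).imp fun j hj => Subtype.ext hj
      · exact fun j => Subtype.ext (hanext c (u + j))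
      · exact fun j => Subtype.ext (hanext c' (v + j))
      · refine fun j k => ⟨fun h => Subtype.ext ?_, fun h => Subtype.ext ?_⟩
        · exact hadet _ _ _ ((hV j k).1 (congrArg K.o (congrArg Subtype.val h)))
        · exact hadet _ _ _ ((hV j k).2 (congrArg K.o (congrArg Subtype.val h)))
      · refine fun j k => ⟨fun h => Subtype.ext ?_, fun h => Subtype.ext ?_⟩
        · exact (hV j k).1 (congrArg Subtype.val h)
        · exact (hV j k).2 (congrArg Subtype.val h)
      · exact fun j => h1 j)
    -- A cycle in the component projects to a cycle of the factor, which meets the marking.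
    (fun c hc => by
      obtain ⟨n, f, i, hi⟩ := hcirc (rep c)
      obtain ⟨j, hj⟩ := hB n ((fibreProduct.fst γ l).comp ((coreIncl _).comp f))
      obtain ⟨k, hk⟩ := hvisit c (Finset.mem_filter.1 hc).2 n f i hi j
      exact ⟨k, by rw [← hk]; exact hj⟩)
    (fun c hc => by
      obtain ⟨n, f, i, hi⟩ := hcirc (rep c)
      obtain ⟨j, hj⟩ := hB' n ((fibreProduct.snd γ l).comp ((coreIncl _).comp f))
      obtain ⟨k, hk⟩ := hvisit c (Finset.mem_filter.1 hc).2 n f i hi j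
      exact ⟨k, by rw [← hk]; exact hj⟩)
  -- Components are disjoint, so a doubly marked vertex identifies its component.
  have c2 : (T.filter fun c => ¬ U c).card ≤ (B ×ˢ B').card := by
    have hmarked : ∀ c ∈ T.filter fun c => ¬ U c, ∃ v : K.V, K.toPi0 v = c ∧
        v.1.1.1 ∈ B ∧ v.1.1.2 ∈ B' := by
      intro c hc
      have := (Finset.mem_filter.1 hc).2
      simp only [hU, IsUnmarked] at this
      push Not at this
      exact this
    by_cases hne : Nonempty K.V
    · choose! w hw using hmarked
      refine Finset.card_le_card_of_injOn (fun c => ((w c).1.1.1, (w c).1.1.2))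
        (fun c hc => Finset.mem_coe.2 (Finset.mem_product.2 (hw c hc).2)) fun c hc c' hc' he => ?_
      have hww : w c = w c' := Subtype.ext (Subtype.ext he)
      rw [← (hw c hc).1, ← (hw c' hc').1, hww]
    · rw [Finset.card_eq_zero.2]
      · exact Nat.zero_le _
      · exact Finset.eq_empty_of_forall_notMem fun c _ => hne ⟨rep c⟩
  rw [Finset.card_product] at c2
  rw [← Finset.card_filter_add_card_filter_not (s := T) U]
  exact Nat.add_le_add c1 c2

end

/-! ### The final count -/

theorem card_quotient_le {α : Type*} (s : Setoid α) (N : ℕ)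
    (h : ∀ T : Finset α, (∀ c ∈ T, ∀ c' ∈ T, s c c' → c = c') → T.card ≤ N) :
    ENat.card (Quotient s) ≤ N := by
  classical
  obtain ⟨U, hU, hmem⟩ := exists_finset_of_card_le (fun _ : Quotient s => True) N fun T _ => by
    rw [← Finset.card_image_of_injOn (f := Quotient.out) (s := T)
      fun _ _ _ _ h => Quotient.out_injective h]
    refine h _ fun c hc c' hc' hcc => ?_
    obtain ⟨q, -, rfl⟩ := Finset.mem_image.1 hc
    obtain ⟨q', -, rfl⟩ := Finset.mem_image.1 hc'
    rw [Quotient.out_equiv_out.1 hcc]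
  have huniv : (Set.univ : Set (Quotient s)) = U := by
    ext q
    simp [hmem q]
  rw [← Set.encard_univ, huniv, Set.encard_coe_eq_coe_finsetCard]
  exact_mod_cast hU

theorem numFreeHomotopyClasses_eq_zero {G D : DirGraph} (f : Hom G D) (h : IsEmpty G.V) :
    f.numFreeHomotopyClasses = 0 := by
  refine (ENat.card_eq_zero_iff_empty _).2 ⟨fun q => ?_⟩
  obtain ⟨c, -⟩ := Quotient.exists_rep q
  obtain ⟨v, -⟩ := Quot.exists_rep c
  exact h.elim v

theorem not_exists_circle_of_betti1_eq_zero {G : DirGraph} (h : G.betti1 = 0) (n : ℕ)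
    (f : Hom (circle n) G) : False := by
  obtain ⟨hfin, hrank⟩ := finiteDimensional_cycles (G := G) (by rw [h]; exact ENat.zero_ne_top)
  have := card_le_of_private_edges (G := G) {()} (fun _ => n) (fun _ => f) (fun _ => f.edge 0)
    fun _ _ _ _ => ⟨fun _ => rfl, fun _ => ⟨0, rfl⟩⟩
  rw [h] at hrank
  have h0 : Module.finrank ℚ (LinearMap.ker G.boundary) = 0 := by exact_mod_cast hrank
  rw [h0] at this
  simp at this

end DirGraph

theorem mainTheorem2 {G L D : DirGraph} (γ : DirGraph.Hom G D) (l : DirGraph.Hom L D)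
    (hγ : γ.IsForwardsImmersion) (hl : l.IsForwardsImmersion) :
    (DirGraph.coreToBase γ l).numFreeHomotopyClasses ≤ 40538 * (G.betti1 * L.betti1) ^ 2 := by
  open DirGraph in
  -- Without cycles in one factor the core is empty. This case precedes the infinite one because `0
  -- * ⊤ = 0`.
  by_cases hG0 : G.betti1 = 0
  · rw [numFreeHomotopyClasses_eq_zero]
    · exact zero_le
    · exact ⟨fun v => by
        obtain ⟨n, f, -⟩ := exists_circle_in_core v
        exact not_exists_circle_of_betti1_eq_zero hG0 n
          ((fibreProduct.fst γ l).comp ((coreIncl _).comp f))⟩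
  by_cases hL0 : L.betti1 = 0
  · rw [numFreeHomotopyClasses_eq_zero]
    · exact zero_le
    · exact ⟨fun v => by
        obtain ⟨n, f, -⟩ := exists_circle_in_core v
        exact not_exists_circle_of_betti1_eq_zero hL0 n
          ((fibreProduct.snd γ l).comp ((coreIncl _).comp f))⟩
  by_cases hG : G.betti1 = ⊤
  · rw [hG, ENat.top_mul hL0, pow_two, ENat.top_mul ENat.top_ne_zero,
      ENat.mul_top (by norm_num)]
    exact le_top
  by_cases hL : L.betti1 = ⊤
  · rw [hL, ENat.mul_top hG0, pow_two, ENat.top_mul ENat.top_ne_zero,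
      ENat.mul_top (by norm_num)]
    exact le_top
  obtain ⟨hfG, hmG⟩ := finiteDimensional_cycles hG
  obtain ⟨hfL, hmL⟩ := finiteDimensional_cycles hL
  obtain ⟨B, E, hBc, hEc, hE, hu, hB⟩ := exists_marking (G := G)
  obtain ⟨B', E', hBc', hEc', hE', hu', hB'⟩ := exists_marking (G := L)
  rw [← hmG] at hG0 ⊢
  rw [← hmL] at hL0 ⊢
  generalize Module.finrank ℚ (LinearMap.ker G.boundary) = m at *
  generalize Module.finrank ℚ (LinearMap.ker L.boundary) = n at *
  have hm : 1 ≤ m := Nat.one_le_iff_ne_zero.2 fun h => hG0 (by rw [h]; rfl)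
  have hn : 1 ≤ n := Nat.one_le_iff_ne_zero.2 fun h => hL0 (by rw [h]; rfl)
  refine (card_quotient_le _ (40538 * (m * n) ^ 2) fun T hT => ?_).trans (le_of_eq (by push_cast; rfl))
  refine (card_components_le (hγ.isMarking hu) (hl.isMarking hu') hE hE' hB hB' T hT).trans ?_
  -- Since m, n ≥ 1, the added units are absorbed: |B| + 1 ≤ 3m, and the lone 1 is at most mn. The
  -- total is (9 + 1) · 72 + 4 = 724.
  calc ((B.card + 1) * (B'.card + 1) + 1) * (E.card * E'.card * 8) + B.card * B'.card
      ≤ ((3 * m) * (3 * n) + m * n) * ((3 * m) * (3 * n) * 8) + (2 * m) * (2 * n) * (m * n) := by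
        have hmn : 1 ≤ m * n := Nat.mul_le_mul hm hn
        refine Nat.add_le_add (Nat.mul_le_mul (Nat.add_le_add (Nat.mul_le_mul (by omega) (by omega))
          hmn) (Nat.mul_le_mul (Nat.mul_le_mul hEc hEc') le_rfl)) ?_
        exact (Nat.mul_le_mul hBc hBc').trans (Nat.le_mul_of_pos_right _ hmn)
    _ = 724 * (m * n) ^ 2 := by ring
    _ ≤ 40538 * (m * n) ^ 2 := Nat.mul_le_mul_right _ (by norm_num)
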